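/- Let $h$ be a real number. There exist constants $c_0>1$, $c_1>0$ and $M>0$, depending only on $h$, such that the following holds for all integers $n\ge 1$ and $k\ge 1$, all $p\in[0,1]$ with $np\ge c_0\log n$, and all scores $\alpha_1,\dots,\alpha_n>0$ with $\max_i\alpha_i/\min_i\alpha_i\le h$. Let $\pi=(\alpha_1,\dots,\alpha_n)/\sum_{i}\alpha_i$ and, for $i\ne j$, let $p_{ij}=\alpha_j/(\alpha_i+\alpha_j)$ (the Bradley–Terry–Luce probability that $j$ is preferred over $i$). Let $\mathcal G$ be an Erdős–Rényi graph on $\{1,\dots,n\}$ with edge probability $p$, i.e. each pair $i<j$ is an edge independently with probability $p$. Independently of $\mathcal G$, each edge $\{i,j\}$ with $i<j$ is compared $k$ times, with independent outcomes, where $j$ beats $i$ with probability $p_{ij}$ each time. For an edge $\{i,j\}$, let $\hat p_{ij}$ be the fraction of the $k$ comparisons of $i$ and $j$ that $j$ won (so $\hat p_{ji}=1-\hat p_{ij}$), let $d$ be the maximum degree of $\mathcal G$, and let $\hat S\in\mathbb R^{n\times n}$ be the empirical Markov matrix $$\hat S_{ij}=\begin{cases}\hat p_{ij}/d & \text{if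 } \{i,j\}\text{ is an edge of }\mathcal G,\\ 1-\frac1d\sum_{l:\{i,l\}\text{ is an edge}}\hat p_{il} & \text{if } i=j,\\ 0&\text{otherwise}\end{cases}$$ (the identity matrix if $\mathcal G$ has no edges). Then, with probability at least $1-M n^{-5}$, $\hat S$ has a unique stationary distribution $\hat\pi$ (the estimate of the unweighted spectral method), and $$\frac{\|\hat\pi-\pi\|_\infty}{\|\pi\|_\infty}\le c_1\sqrt{\frac{\log n}{npk}},$$ where the right-hand side is read as $0$ for $n=1$. -/

import Mathlib

open MeasureTheory ProbabilityTheory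

noncomputable section

namespace SpectralRanking

/-- The unordered pairs of distinct items, each written as `(i, j)` with `i < j`. -/
abbrev Pair (n : ℕ) : Type := {e : Fin n × Fin n // e.1 < e.2}

/-- The Bradley-Terry-Luce probability `p_ij` that item `j` is preferred over item `i`. -/
def prefProb {n : ℕ} (α : Fin n → ℝ) (i j : Fin n) : ℝ := α j / (α i + α j)

/-- The canonical score vector `π`: the scores `α`, normalized to have sum one. -/
def canonicalScore {n : ℕ} (α : Fin n → ℝ) : Fin n → ℝ := fun i => α i / ∑ l, α l

/-- The comparison model on a probability space `(Ω, μ)`: `G` is an Erdős–Rényi graph `G(n, p)`, and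
`Z e m` is the outcome of the `m`-th comparison of the pair `e = (i, j)`, `i < j`, with value `true`
iff `j` beats `i`. The outcomes are independent of each other and of the graph, and `Z e m` is
Bernoulli with parameter `p_ij`. Only the outcomes on the edges of `G` are observed: the others do
not enter the empirical Markov matrix below. -/
structure IsComparisonModel {n k : ℕ} (p : unitInterval) (α : Fin n → ℝ)
    {Ω : Type*} [MeasurableSpace Ω] (μ : Measure Ω)
    (G : Ω → SimpleGraph (Fin n)) (Z : Pair n → Fin k → Ω → Bool) : Prop where
  graph_law : HasLaw G (SimpleGraph.binomialRandom (Fin n) p) μ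
  outcome_measurable : ∀ e m, Measurable (Z e m)
  outcome_law : ∀ e m, μ.real {ω | Z e m ω = true} = prefProb α e.1.1 e.1.2
  outcome_indep : iIndepFun (fun x : Pair n × Fin k => Z x.1 x.2) μ
  graph_outcome_indep : IndepFun G (fun ω (x : Pair n × Fin k) => Z x.1 x.2 ω) μ

/-- The number of the `k` comparisons of `i` and `j` that `j` wins, in either order of `i`, `j`. -/
def wins {n k : ℕ} (z : Pair n → Fin k → Bool) (i j : Fin n) : ℕ :=
  if hij : i < j then (Finset.univ.filter fun m => z ⟨(i, j), hij⟩ m = true).card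
  else if hji : j < i then (Finset.univ.filter fun m => z ⟨(j, i), hji⟩ m = false).card
  else 0

/-- The empirical probability that `j` beats `i`. -/
def empProb {n k : ℕ} (z : Pair n → Fin k → Bool) (i j : Fin n) : ℝ := (wins z i j : ℝ) / k

open Classical in
/-- The Markov matrix of the comparison graph `G` with pairwise probabilities `P`: the transition
from `i` to a neighbour `j` has probability `P i j / d`, with `d` the maximum degree of `G`, and the
rest of row `i` is on the diagonal. -/
def markovMatrix {n : ℕ} (G : SimpleGraph (Fin n)) (P : Fin n → Fin n → ℝ) :
    Matrix (Fin n) (Fin n) ℝ :=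
  fun i j =>
    if G.Adj i j then P i j / (G.maxDegree : ℝ)
    else if i = j then
      1 - 1 / (G.maxDegree : ℝ) * ∑ l ∈ Finset.univ.filter (fun l => G.Adj i l), P i l
    else 0

/-- The probability vector `ρ` is a stationary distribution of `S`: `ρᵀ S = ρᵀ`. -/
def IsStationaryDistribution {n : ℕ} (S : Matrix (Fin n) (Fin n) ℝ) (ρ : Fin n → ℝ) : Prop :=
  ρ ∈ stdSimplex ℝ (Fin n) ∧ Matrix.vecMul ρ S = ρ

end SpectralRanking

end

/-! Write A for the adjacency matrix, P for the empirical probabilities, d for np in this proof. A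
probability vector is stationary exactly when the net flow `flow A P` out of every vertex vanishes;
the maximum degree is a common factor and drops out. Since P i j + P j i = 1 on edges, the form ∑
x_i (flow x)_i equals ∑ D_i x_i² − ½ ∑ A_ij x_i x_j with D_i = ∑_j A_ij P_ij, without any
reversibility. Bounded score ratios give D_i ≥ 2λd + 1. On vectors of sum zero the mean of A
contributes nothing positive, so the form of A is at most 2λd once A − E A is a small multiple of d.
Hence the flow is coercive with constant λd and invertible on sum-zero vectors: π has a unique
balanced correction x, and π + x is the stationary distribution (`nonneg_of_unique_balanced` gives
its sign).

Coercivity bounds x only in the Euclidean norm. The entry x_l is reached by leave-one-out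
(`exists_balanced_perturbation`). Let v be the balanced correction with v_l = 0 once the edges at l
are deleted. It does not depend on those edges, so the flow of π + v in the full graph is small at l
by concentration; elsewhere it lives on the neighbours of l. Coercivity bounds x − v in the
Euclidean norm by O(B/d) + ‖v‖/4, where B bounds the flow of π. As |x_l| ≤ ‖x − v‖₂ and ‖v‖ ≤ ‖x‖ +
‖x − v‖₂, the maximum over l absorbs ‖x‖.

By detailed balance of the true chain the flow of π is a weighted sum of comparison noise, so B is
of order ‖π‖ √(d log n / k). The spectral input needs only a small multiple of d, not the sharp
order √d. It follows from a discrepancy bound over pairs of vertex sets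
(`measureReal_exists_discrepancy_le`), turned into a bound on quadratic forms by binary expansion
(`abs_quadratic_le`). All tail bounds come from one Bernstein inequality,
`measureReal_abs_sum_centered_ge_le`. -/

noncomputable section

namespace SpectralRanking

/-! ### Flow operator, coercivity, and the deterministic leave-one-out argument -/

section Flow

variable {ι : Type*}

/-- The weights `A` with the vertex `l` made isolated. -/
def isolate (A : ι → ι → ℝ) (l : ι) : ι → ι → ℝ :=
  open Classical in fun i j => if i = l ∨ j = l then 0 else A i j

lemma isolate_left (A : ι → ι → ℝ) (l j : ι) : isolate A l l j = 0 := by simp [isolate]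

lemma isolate_of_ne {A : ι → ι → ℝ} {l i j : ι} (hi : i ≠ l) (hj : j ≠ l) :
    isolate A l i j = A i j := by simp [isolate, hi, hj]

lemma isolate_comm {A : ι → ι → ℝ} (hA : ∀ i j, A i j = A j i) (l i j : ι) :
    isolate A l i j = isolate A l j i := by
  by_cases hi : i = l <;> by_cases hj : j = l <;> simp [isolate, hi, hj, hA i j]

variable [Fintype ι]

/-- The net flow out of each vertex when the mass `x` moves along the weighted edges `A` with
transition rates `P`. -/
def flow (A P : ι → ι → ℝ) : (ι → ℝ) →ₗ[ℝ] (ι → ℝ) where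
  toFun x i := ∑ j, A i j * (P i j * x i - P j i * x j)
  map_add' x y := by
    funext i
    simp only [Pi.add_apply, ← Finset.sum_add_distrib]
    exact Finset.sum_congr rfl fun j _ => by ring
  map_smul' c x := by
    funext i
    simp only [Pi.smul_apply, smul_eq_mul, RingHom.id_apply, Finset.mul_sum]
    exact Finset.sum_congr rfl fun j _ => by ring

lemma flow_apply (A P : ι → ι → ℝ) (x : ι → ℝ) (i : ι) :
    flow A P x i = ∑ j, A i j * (P i j * x i - P j i * x j) := rfl

lemma sum_flow {A P : ι → ι → ℝ} (hA : ∀ i j, A i j = A j i) (x : ι → ℝ) :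
    ∑ i, flow A P x i = 0 := by
  have h : ∑ i, flow A P x i = -∑ i, flow A P x i := by
    simp only [flow_apply]
    conv_rhs => rw [Finset.sum_comm]
    simp only [← Finset.sum_neg_distrib]
    refine Finset.sum_congr rfl fun i _ => Finset.sum_congr rfl fun j _ => ?_
    rw [hA i j]; ring
  linarith

/-- Swapping the indices pairs P i j with P j i in the cross term; their sum is 1 on every edge, so
the cross term no longer depends on P. -/
lemma sum_mul_flow {A P : ι → ι → ℝ} (hA : ∀ i j, A i j = A j i)
    (hP : ∀ i j, A i j * (P i j + P j i) = A i j) (x : ι → ℝ) :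
    ∑ i, x i * flow A P x i =
      ∑ i, (∑ j, A i j * P i j) * x i ^ 2 - (∑ i, ∑ j, A i j * x i * x j) / 2 := by
  have h1 : ∑ i, x i * flow A P x i =
      ∑ i, (∑ j, A i j * P i j) * x i ^ 2 - ∑ i, ∑ j, A i j * P j i * x i * x j := by
    simp only [flow_apply, Finset.mul_sum, Finset.sum_mul, ← Finset.sum_sub_distrib]
    exact Finset.sum_congr rfl fun i _ => Finset.sum_congr rfl fun j _ => by ring
  have h2 : ∑ i, ∑ j, A i j * P j i * x i * x j = ∑ i, ∑ j, A i j * P i j * x i * x j := by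
    rw [Finset.sum_comm]
    refine Finset.sum_congr rfl fun i _ => Finset.sum_congr rfl fun j _ => ?_
    rw [hA j i]; ring
  have h3 : ∑ i, ∑ j, A i j * P j i * x i * x j + ∑ i, ∑ j, A i j * P i j * x i * x j =
      ∑ i, ∑ j, A i j * x i * x j := by
    simp only [← Finset.sum_add_distrib]
    refine Finset.sum_congr rfl fun i _ => Finset.sum_congr rfl fun j _ => ?_
    linear_combination (x i * x j) * hP i j
  linarith

/-- The row sums matter only where x is nonzero, so the estimate still applies after a vertex has
been isolated, for vectors vanishing there. -/
lemma flow_coercive {A P : ι → ι → ℝ} {lam : ℝ} (hA : ∀ i j, A i j = A j i)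
    (hP : ∀ i j, A i j * (P i j + P j i) = A i j) {x : ι → ℝ}
    (hD : ∀ i, x i ≠ 0 → 2 * lam ≤ ∑ j, A i j * P i j)
    (hx : ∑ i, ∑ j, A i j * x i * x j ≤ 2 * lam * ∑ i, x i ^ 2) :
    lam * ∑ i, x i ^ 2 ≤ ∑ i, x i * flow A P x i := by
  rw [sum_mul_flow hA hP]
  have : 2 * lam * ∑ i, x i ^ 2 ≤ ∑ i, (∑ j, A i j * P i j) * x i ^ 2 := by
    rw [Finset.mul_sum]
    refine Finset.sum_le_sum fun i _ => ?_
    by_cases h : x i = 0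
    · simp [h]
    · exact mul_le_mul_of_nonneg_right (hD i h) (sq_nonneg _)
  linarith

/-- The Euclidean norm. -/
def l2 (x : ι → ℝ) : ℝ := √(∑ i, x i ^ 2)

lemma l2_nonneg (x : ι → ℝ) : 0 ≤ l2 x := Real.sqrt_nonneg _

lemma l2_sq (x : ι → ℝ) : l2 x ^ 2 = ∑ i, x i ^ 2 :=
  Real.sq_sqrt (Finset.sum_nonneg fun _ _ => sq_nonneg _)

lemma abs_le_l2 (x : ι → ℝ) (i : ι) : |x i| ≤ l2 x := by
  apply Real.abs_le_sqrt
  exact Finset.single_le_sum (f := fun i => x i ^ 2) (fun _ _ => sq_nonneg _) (Finset.mem_univ i)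

lemma l2_neg (x : ι → ℝ) : l2 (-x) = l2 x := by simp [l2]

lemma sum_mul_le_l2 (x y : ι → ℝ) : ∑ i, x i * y i ≤ l2 x * l2 y :=
  Real.sum_mul_le_sqrt_mul_sqrt _ _ _

lemma l2_le_of_coercive {A P : ι → ι → ℝ} {lam : ℝ} (hlam : 0 < lam) {x : ι → ℝ}
    (h : lam * ∑ i, x i ^ 2 ≤ ∑ i, x i * flow A P x i) : l2 x ≤ l2 (flow A P x) / lam := by
  rw [le_div_iff₀ hlam]
  have h1 := h.trans (sum_mul_le_l2 x (flow A P x))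
  rw [← l2_sq] at h1
  by_contra! hc
  have h2 : 0 < l2 x := by
    by_contra! h0
    have : l2 x = 0 := le_antisymm h0 (l2_nonneg _)
    rw [this] at hc
    have := l2_nonneg (flow A P x)
    linarith
  nlinarith

/-- The vectors of sum zero that vanish on `U`. -/
def sumZero (U : Set ι) : Submodule ℝ (ι → ℝ) where
  carrier := {x | ∑ i, x i = 0 ∧ ∀ i ∈ U, x i = 0}
  add_mem' := by
    rintro x y ⟨hx, hx'⟩ ⟨hy, hy'⟩
    exact ⟨by simp [Finset.sum_add_distrib, hx, hy], fun i hi => by simp [hx' i hi, hy' i hi]⟩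
  zero_mem' := by simp
  smul_mem' := by
    rintro c x ⟨hx, hx'⟩
    exact ⟨by simp [← Finset.mul_sum, hx], fun i hi => by simp [hx' i hi]⟩

lemma flow_eq_zero_of_isolated {A P : ι → ι → ℝ} {i : ι} (h : ∀ j, A i j = 0) (x : ι → ℝ) :
    flow A P x i = 0 := by
  rw [flow_apply]
  exact Finset.sum_eq_zero fun j _ => by rw [h j, zero_mul]

lemma flow_mem_sumZero {A P : ι → ι → ℝ} {U : Set ι} (hA : ∀ i j, A i j = A j i)
    (hU : ∀ i ∈ U, ∀ j, A i j = 0) (x : ι → ℝ) : flow A P x ∈ sumZero U :=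
  ⟨sum_flow hA x, fun i hi => flow_eq_zero_of_isolated (hU i hi) x⟩

lemma eq_zero_of_flow_eq_zero {A P : ι → ι → ℝ} {lam : ℝ} (hlam : 0 < lam) {x : ι → ℝ}
    (h : lam * ∑ i, x i ^ 2 ≤ ∑ i, x i * flow A P x i) (hx : flow A P x = 0) : x = 0 := by
  have h1 := l2_le_of_coercive hlam h
  have h2 : l2 x ≤ 0 := by simpa [hx, l2] using h1
  funext i
  exact abs_eq_zero.1 (le_antisymm ((abs_le_l2 x i).trans h2) (abs_nonneg _))

/-- Coercivity makes the flow injective on `sumZero U`, a finite-dimensional space that it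
preserves, hence surjective. -/
lemma exists_flow_eq {A P : ι → ι → ℝ} {U : Set ι} {lam : ℝ} (hlam : 0 < lam)
    (hA : ∀ i j, A i j = A j i) (hU : ∀ i ∈ U, ∀ j, A i j = 0)
    (hc : ∀ x ∈ sumZero U, lam * ∑ i, x i ^ 2 ≤ ∑ i, x i * flow A P x i)
    {r : ι → ℝ} (hr : r ∈ sumZero U) : ∃ x ∈ sumZero U, flow A P x = r := by
  let f : sumZero U →ₗ[ℝ] sumZero U :=
    (flow A P).restrict fun x _ => flow_mem_sumZero hA hU x
  have hinj : Function.Injective f := by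
    rw [← LinearMap.ker_eq_bot, LinearMap.ker_eq_bot']
    rintro ⟨x, hx⟩ h
    have h' : flow A P x = 0 := congrArg Subtype.val h
    exact Subtype.ext (eq_zero_of_flow_eq_zero hlam (hc x hx) h')
  obtain ⟨⟨x, hx⟩, h⟩ := (LinearMap.injective_iff_surjective.1 hinj) ⟨r, hr⟩
  exact ⟨x, hx, congrArg Subtype.val h⟩

lemma sum_isolate {A : ι → ι → ℝ} {l i : ι} (hi : i ≠ l) (f : ι → ℝ) :
    ∑ j, isolate A l i j * f j = ∑ j, A i j * f j - A i l * f l := by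
  classical
  rw [← Finset.add_sum_erase _ _ (Finset.mem_univ l), ← Finset.add_sum_erase Finset.univ
    (fun j => A i j * f j) (Finset.mem_univ l)]
  have : ∑ j ∈ Finset.univ.erase l, isolate A l i j * f j =
      ∑ j ∈ Finset.univ.erase l, A i j * f j :=
    Finset.sum_congr rfl fun j hj => by rw [isolate_of_ne hi (Finset.ne_of_mem_erase hj)]
  rw [this]
  simp [isolate]

/-- A perturbation of `π` that is balanced once the vertex `l` has been isolated, and does not
change the mass at `l`. -/
def leaveOneOut (A' P : ι → ι → ℝ) (ρ : ι → ℝ) (l : ι) : ι → ℝ :=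
  -- A choice that is total in A', even when no solution exists: the vector is then a function of
  -- the weights with l isolated on every outcome, which is what independence needs.
  Classical.epsilon fun x => x ∈ sumZero {l} ∧ flow A' P (ρ + x) = 0

lemma l2_le_of_abs_le {x : ι → ℝ} {b : ℝ} (hb : 0 ≤ b) (h : ∀ i, |x i| ≤ b) :
    l2 x ≤ b * √(Fintype.card ι) := by
  apply Real.sqrt_le_iff.2 ⟨by positivity, ?_⟩
  rw [mul_pow, Real.sq_sqrt (by positivity)]
  calc ∑ i, x i ^ 2 ≤ ∑ _i : ι, b ^ 2 :=
        Finset.sum_le_sum fun i _ => sq_le_sq' (neg_le_of_abs_le (h i)) (le_of_abs_le (h i))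
    _ = b ^ 2 * Fintype.card ι := by simp [mul_comm]

lemma abs_sum_mul_le {c x : ι → ℝ} (hc : ∀ i, |c i| ≤ 1) :
    |∑ i, c i * x i| ≤ √(Fintype.card ι) * l2 x := by
  have h1 : l2 c ≤ √(Fintype.card ι) := by simpa using l2_le_of_abs_le zero_le_one hc
  have h2 := sum_mul_le_l2 c x
  have h3 := sum_mul_le_l2 c (-x)
  rw [l2_neg] at h3
  simp only [Pi.neg_apply, mul_neg, Finset.sum_neg_distrib] at h3
  have h4 := mul_le_mul_of_nonneg_right h1 (l2_nonneg x)
  rw [abs_le]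
  constructor <;> linarith

/-- The entrywise bound with all randomness removed. The hypothesis `hloo` is the only place where
the independence of the leave-one-out vector from the edges at l enters. -/
theorem exists_balanced_perturbation [Nonempty ι] [DecidableEq ι] {A P : ι → ι → ℝ} {ρ : ι → ℝ}
    {d lam B e p κ : ℝ}
    (hA : ∀ i j, A i j = A j i) (hA01 : ∀ i j, A i j = 0 ∨ A i j = 1) (hA0 : ∀ i, A i i = 0)
    (hP0 : ∀ i j, 0 ≤ P i j) (hP1 : ∀ i j, P i j ≤ 1) (hPs : ∀ i j, i ≠ j → P i j + P j i = 1)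
    (hrow : ∀ i, |flow A P ρ i| ≤ B)
    (hedge : ∀ i j, i ≠ j → |P i j * ρ i - P j i * ρ j| ≤ e) (heB : √d * e ≤ B)
    (hD : ∀ i, 2 * (lam * d) + 1 ≤ ∑ j, A i j * P i j)
    (hop : ∀ x : ι → ℝ, ∑ i, x i = 0 →
      ∑ i, ∑ j, A i j * x i * x j ≤ 2 * (lam * d) * ∑ i, x i ^ 2)
    (hdeg : ∀ i, ∑ j, A i j ≤ 2 * d)
    (hloo : ∀ l, |∑ j, (A l j - if l = j then 0 else p) *
      (P j l * leaveOneOut (isolate A l) P ρ l j)| ≤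
      κ * d * ‖leaveOneOut (isolate A l) P ρ l‖)
    (hp : 0 ≤ p) (hpd : p * Fintype.card ι = d) (hlam : 0 < lam) (hκ : κ = lam / 8)
    (hd : 1 ≤ d) (hκd : 2 ≤ κ ^ 2 * d) :
    (∀ x ∈ sumZero (∅ : Set ι), flow A P x = 0 → x = 0) ∧
    ∃ x ∈ sumZero (∅ : Set ι), flow A P (ρ + x) = 0 ∧
      ‖x‖ ≤ 2 * ((3 + 2 / lam) / lam) * (B / d) := by
  have hd0 : 0 < d := by linarith
  have hlamd : 0 < lam * d := mul_pos hlam hd0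
  have hκ0 : 0 < κ := by rw [hκ]; positivity
  have hAP : ∀ i j, A i j * (P i j + P j i) = A i j := by
    intro i j
    by_cases h : i = j
    · subst h; simp [hA0]
    · rw [hPs i j h, mul_one]
  have hB : 0 ≤ B := (abs_nonneg _).trans (hrow (Classical.arbitrary ι))
  have hcoer : ∀ x ∈ sumZero (∅ : Set ι),
      lam * d * ∑ i, x i ^ 2 ≤ ∑ i, x i * flow A P x i := fun x hx =>
    flow_coercive hA hAP (fun i _ => by linarith [hD i]) (hop x hx.1)
  have hker : ∀ x ∈ sumZero (∅ : Set ι), flow A P x = 0 → x = 0 := fun x hx h =>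
    eq_zero_of_flow_eq_zero hlamd (hcoer x hx) h
  refine ⟨hker, ?_⟩
  obtain ⟨x, hx, hfx⟩ := exists_flow_eq hlamd hA (by simp) hcoer
    (neg_mem (flow_mem_sumZero (U := ∅) (P := P) hA (by simp) ρ))
  refine ⟨x, hx, by rw [map_add, hfx, add_neg_cancel], ?_⟩
  set b : ℝ := B / d with hb
  have hb0 : 0 ≤ b := by positivity
  have hBd : B = b * d := by rw [hb]; field_simp
  set C := (3 + 2 / lam) / lam with hC
  have hC0 : 0 ≤ C := by positivity
  -- The maximum over l puts ‖x‖ on both sides; the coefficient 1/3 lets it be absorbed.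
  suffices key : ∀ l, |x l| ≤ 4 / 3 * (C * b) + 1 / 3 * ‖x‖ by
    have : ‖x‖ ≤ 4 / 3 * (C * b) + 1 / 3 * ‖x‖ :=
      (pi_norm_le_iff_of_nonneg (by positivity)).2 fun l => by
        simpa [Real.norm_eq_abs] using key l
    linarith
  intro l
  set A' := isolate A l with hA'
  have hA's : ∀ i j, A' i j = A' j i := isolate_comm hA l
  have hA'P : ∀ i j, A' i j * (P i j + P j i) = A' i j := by
    intro i j
    by_cases h : i = l ∨ j = l
    · simp [hA', isolate, h]
    · simpa [hA', isolate, h] using hAP i j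
  have hA'l : ∀ i ∈ ({l} : Set ι), ∀ j, A' i j = 0 := by
    rintro i rfl j; exact isolate_left A _ j
  have hcoer' : ∀ y ∈ sumZero ({l} : Set ι),
      lam * d * ∑ i, y i ^ 2 ≤ ∑ i, y i * flow A' P y i := by
    intro y hy
    have hyl : y l = 0 := hy.2 l rfl
    refine flow_coercive hA's hA'P (fun i hi => ?_) ?_
    · have hil : i ≠ l := by rintro rfl; exact hi hyl
      rw [hA', sum_isolate hil]
      -- Isolating l removes at most one edge at i, which the `+ 1` in `hD` pays for.
      have h1 : A i l * P i l ≤ 1 := by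
        rcases hA01 i l with h | h <;> simp [h, hP1 i l]
      linarith [hD i]
    · refine le_trans (le_of_eq ?_) (hop y hy.1)
      refine Finset.sum_congr rfl fun i _ => Finset.sum_congr rfl fun j _ => ?_
      by_cases hi : i = l
      · subst hi; simp [hyl]
      by_cases hj : j = l
      · subst hj; simp [hyl]
      rw [hA', isolate_of_ne hi hj]
  obtain ⟨v₀, hv₀, hfv₀⟩ := exists_flow_eq hlamd hA's hA'l hcoer'
    (neg_mem (flow_mem_sumZero (P := P) hA's hA'l ρ))
  have hv : leaveOneOut A' P ρ l ∈ sumZero {l} ∧ flow A' P (ρ + leaveOneOut A' P ρ l) = 0 :=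
    Classical.epsilon_spec (p := fun x => x ∈ sumZero {l} ∧ flow A' P (ρ + x) = 0)
      ⟨v₀, hv₀, by rw [map_add, hfv₀, add_neg_cancel]⟩
  have hlo := hloo l
  set v := leaveOneOut A' P ρ l with hvdef
  obtain ⟨hvm, hvf⟩ := hv
  have hvl : v l = 0 := hvm.2 l rfl
  have hlo' : |∑ j, (A l j - p) * (P j l * v j)| ≤ κ * d * ‖v‖ := by
    refine le_trans (le_of_eq ?_) hlo
    congr 1
    refine Finset.sum_congr rfl fun j _ => ?_
    by_cases hj : l = j
    · subst hj; simp [hvl]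
    · rw [if_neg hj]
  have hfv : flow A' P v = -flow A' P ρ := by
    rw [map_add] at hvf; exact eq_neg_of_add_eq_zero_right hvf
  -- With a single vertex `hedge` is vacuous and e may be negative; there x l is the sum of x, hence
  -- zero.
  have he : 0 ≤ e ∨ ∀ i j : ι, i = j := by
    by_cases h : ∀ i j : ι, i = j
    · exact Or.inr h
    · push Not at h
      obtain ⟨i, j, hij⟩ := h
      exact Or.inl ((abs_nonneg _).trans (hedge i j hij))
  rcases he with he | hsub
  swap
  · have h1 : ∑ i, x i = x l := by
      rw [Finset.sum_eq_single l (fun i _ h => absurd (hsub i l) h) (by simp)]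
    rw [hx.1] at h1
    rw [← h1, abs_zero]; positivity
  have heB' : e ≤ B := le_trans (by
    have : 1 ≤ √d := Real.one_le_sqrt.2 hd
    nlinarith) heB
  have hA1 : ∀ i j, |A i j| ≤ 1 := fun i j => by rcases hA01 i j with h | h <;> simp [h]
  have hAnn : ∀ i j, 0 ≤ A i j := fun i j => by rcases hA01 i j with h | h <;> simp [h]
  have hPabs : ∀ i j, |P i j| ≤ 1 := fun i j => abs_le.2 ⟨by linarith [hP0 i j], hP1 i j⟩
  -- The Euclidean norm of the leave-one-out perturbation.
  have hv2 : l2 v ≤ 2 * B * √(Fintype.card ι) / (lam * d) := by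
    refine (l2_le_of_coercive hlamd (hcoer' v hvm)).trans ?_
    rw [hfv, l2_neg]
    gcongr
    refine l2_le_of_abs_le (by positivity) fun i => ?_
    by_cases hi : i = l
    · rw [hi, flow_eq_zero_of_isolated (hA'l l rfl)]; simp; exact hB
    · rw [flow_apply, hA', sum_isolate hi, ← flow_apply]
      refine (abs_sub _ _).trans ?_
      have h1 : |A i l * (P i l * ρ i - P l i * ρ l)| ≤ 1 * e := by
        rw [abs_mul]
        exact mul_le_mul (hA1 i l) (hedge i l hi) (abs_nonneg _) zero_le_one
      linarith [hrow i]
  have hvinf : ∀ i, |v i| ≤ ‖v‖ := fun i => by simpa using norm_le_pi_norm v i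
  -- The residual of the leave-one-out solution in the full graph; the correction x − v has flow −r.
  set r := flow A P (ρ + v) with hr
  have hrl : |r l| ≤ B + (2 / lam) * B + κ * d * ‖v‖ := by
    have h1 : r l = flow A P ρ l - ∑ j, A l j * (P j l * v j) := by
      rw [hr, map_add, Pi.add_apply, flow_apply A P v, sub_eq_add_neg, ← Finset.sum_neg_distrib]
      congr 1
      exact Finset.sum_congr rfl fun j _ => by rw [hvl]; ring
    have h2 : ∑ j, A l j * (P j l * v j) =
        ∑ j, (A l j - p) * (P j l * v j) + p * ∑ j, P j l * v j := by
      rw [Finset.mul_sum, ← Finset.sum_add_distrib]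
      exact Finset.sum_congr rfl fun j _ => by ring
    -- The mean of row l needs only the Euclidean bound on v: the two factors √n and p combine to pn
    -- = d, which cancels.
    have h3 : |p * ∑ j, P j l * v j| ≤ 2 / lam * B := by
      rw [abs_mul, abs_of_nonneg hp]
      calc p * |∑ j, P j l * v j| ≤ p * (√(Fintype.card ι) *
            (2 * B * √(Fintype.card ι) / (lam * d))) := by
            gcongr
            exact (abs_sum_mul_le fun j => hPabs j l).trans (by gcongr)
        _ = (p * (√(Fintype.card ι) * √(Fintype.card ι))) * (2 * B) / (lam * d) := by ring
        _ = 2 / lam * B := by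
            rw [Real.mul_self_sqrt (by positivity), hpd]; field_simp
    rw [h1, h2]
    have h4 := abs_sub (flow A P ρ l)
      (∑ j, (A l j - p) * (P j l * v j) + p * ∑ j, P j l * v j)
    have h5 := abs_add_le (∑ j, (A l j - p) * (P j l * v j)) (p * ∑ j, P j l * v j)
    linarith [hrow l]
  -- Away from l the flow balances except along the restored edge to l.
  have hra : ∀ i, i ≠ l → |r i| ≤ A l i * (e + ‖v‖) := by
    intro i hi
    have h1 : r i = A i l * (P i l * (ρ + v) i - P l i * (ρ + v) l) := by
      have := congrFun hvf i
      rw [flow_apply, hA', sum_isolate hi, ← flow_apply] at this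
      simp only [Pi.zero_apply] at this
      rw [hr]; linarith
    rw [h1, Pi.add_apply, Pi.add_apply, hvl, abs_mul, abs_of_nonneg (hAnn _ _), hA i l]
    refine mul_le_mul_of_nonneg_left ?_ (hAnn _ _)
    have h2 : P i l * (ρ i + v i) - P l i * (ρ l + 0) =
        (P i l * ρ i - P l i * ρ l) + P i l * v i := by ring
    rw [h2]
    refine (abs_add_le _ _).trans (add_le_add (hedge i l hi) ?_)
    rw [abs_mul]
    calc |P i l| * |v i| ≤ 1 * ‖v‖ := by gcongr; exacts [hPabs i l, hvinf i]
      _ = ‖v‖ := one_mul _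
  have hr2 : l2 r ≤ (3 + 2 / lam) * B + 2 * (κ * d * ‖v‖) := by
    have hs : √(2 * d) * (e + ‖v‖) ≤ 2 * B + κ * d * ‖v‖ := by
      have h1 : √(2 * d) * e ≤ 2 * B := by
        rw [Real.sqrt_mul (by norm_num)]
        have : √2 ≤ 2 := by
          rw [Real.sqrt_le_left (by norm_num)]; norm_num
        calc √2 * √d * e = √2 * (√d * e) := by ring
          _ ≤ 2 * B := by gcongr
      have h2 : √(2 * d) ≤ κ * d := by
        rw [Real.sqrt_le_left (by positivity)]
        nlinarith
      have := mul_le_mul_of_nonneg_right h2 (norm_nonneg v)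
      linarith
    have hsum : ∑ i, r i ^ 2 ≤ |r l| ^ 2 + (√(2 * d) * (e + ‖v‖)) ^ 2 := by
      rw [← Finset.add_sum_erase _ _ (Finset.mem_univ l), sq_abs, mul_pow,
        Real.sq_sqrt (by positivity)]
      gcongr
      calc ∑ i ∈ Finset.univ.erase l, r i ^ 2
          ≤ ∑ i ∈ Finset.univ.erase l, A l i * (e + ‖v‖) ^ 2 := by
            refine Finset.sum_le_sum fun i hi => ?_
            have h1 := hra i (Finset.ne_of_mem_erase hi)
            rw [← sq_abs (r i)]
            have h2 : A l i ^ 2 = A l i := by rcases hA01 l i with h | h <;> simp [h]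
            calc |r i| ^ 2 ≤ (A l i * (e + ‖v‖)) ^ 2 := by gcongr
              _ = A l i * (e + ‖v‖) ^ 2 := by rw [mul_pow, h2]
        _ ≤ ∑ i, A l i * (e + ‖v‖) ^ 2 :=
            Finset.sum_le_sum_of_subset_of_nonneg (Finset.erase_subset _ _)
              fun i _ _ => mul_nonneg (hAnn _ _) (sq_nonneg _)
        _ = (∑ i, A l i) * (e + ‖v‖) ^ 2 := by rw [Finset.sum_mul]
        _ ≤ 2 * d * (e + ‖v‖) ^ 2 := by gcongr; exact hdeg l
    have hle : l2 r ≤ |r l| + √(2 * d) * (e + ‖v‖) := by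
      refine Real.sqrt_le_iff.2 ⟨by positivity, hsum.trans ?_⟩
      have : 0 ≤ |r l| * (√(2 * d) * (e + ‖v‖)) := by positivity
      nlinarith
    linarith
  have hΔm : x - v ∈ sumZero (∅ : Set ι) := by
    refine ⟨?_, by simp⟩
    simp [hx.1, hvm.1]
  -- The coefficient of ‖v‖ is 2κ/λ, equal to 1/4 by the choice κ = λ/8.
  have hΔ : l2 (x - v) ≤ C * b + 1 / 4 * ‖v‖ := by
    refine (l2_le_of_coercive hlamd (hcoer _ hΔm)).trans ?_
    have h1 : flow A P (x - v) = -r := by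
      rw [hr, map_sub, map_add, hfx]; abel
    rw [h1, l2_neg, div_le_iff₀ hlamd]
    refine hr2.trans (le_of_eq ?_)
    rw [hBd, hκ, hC]; field_simp; ring
  have hvx : ‖v‖ ≤ ‖x‖ + l2 (x - v) := by
    refine (pi_norm_le_iff_of_nonneg (by have := l2_nonneg (x - v); positivity)).2 fun i => ?_
    have h1 := abs_le_l2 (x - v) i
    have h2 : |x i| ≤ ‖x‖ := by simpa using norm_le_pi_norm x i
    rw [Pi.sub_apply] at h1
    rw [Real.norm_eq_abs]
    have h3 := abs_sub (x i) (x i - v i)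
    rw [sub_sub_cancel] at h3
    linarith
  have hxl := abs_le_l2 (x - v) l
  rw [Pi.sub_apply, hvl, sub_zero] at hxl
  linarith

end Flow

/-! ### From discrepancy to quadratic forms by binary expansion -/

section Discrepancy

lemma exists_binary_digits (m : ℕ) : ∃ F : Finset ℕ, ∑ i ∈ F, 2 ^ i = m :=
  ⟨m.bitIndices.toFinset, by
    rw [List.sum_toFinset _ Nat.bitIndices_sorted.nodup]
    exact Nat.sum_map_two_pow_bitIndices m⟩

/-- Each distance from i is attained at most twice, once on each side. -/
lemma sum_dist_le {N : ℕ} {f : ℕ → ℝ} (hf : ∀ g, 0 ≤ f g) (i : ℕ) :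
    ∑ j ∈ Finset.range N, f (Nat.dist i j) ≤ 2 * ∑ g ∈ Finset.range (N + i + 1), f g := by
  have h1 : ∑ j ∈ (Finset.range N).filter (· ≤ i), f (Nat.dist i j) ≤
      ∑ g ∈ Finset.range (N + i + 1), f g := by
    rw [← Finset.sum_image (f := f) (g := fun j => Nat.dist i j)]
    · refine Finset.sum_le_sum_of_subset_of_nonneg ?_ fun g _ _ => hf g
      intro g
      simp only [Finset.mem_image, Finset.mem_filter, Finset.mem_range, Nat.dist]
      rintro ⟨j, ⟨h1, h2⟩, rfl⟩; omega
    · intro a ha b hb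
      simp only [Finset.coe_filter, Set.mem_ofPred_eq, Nat.dist] at *
      omega
  have h2 : ∑ j ∈ (Finset.range N).filter (¬ · ≤ i), f (Nat.dist i j) ≤
      ∑ g ∈ Finset.range (N + i + 1), f g := by
    rw [← Finset.sum_image (f := f) (g := fun j => Nat.dist i j)]
    · refine Finset.sum_le_sum_of_subset_of_nonneg ?_ fun g _ _ => hf g
      intro g
      simp only [Finset.mem_image, Finset.mem_filter, Finset.mem_range, Nat.dist]
      rintro ⟨j, ⟨h1, h2⟩, rfl⟩; omega
    · intro a ha b hb
      simp only [Finset.coe_filter, Set.mem_ofPred_eq, Nat.dist] at *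
      omega
  rw [← Finset.sum_filter_add_sum_filter_not _ (· ≤ i)]
  linarith

/-- The weight given to a pair of binary digits at distance `g`. -/
def digitWeight (K : ℕ) (β R : ℝ) (g : ℕ) : ℝ := if g ≤ K then β * 2 ^ K else R * (1 / 2) ^ g

lemma digitWeight_nonneg {K : ℕ} {β R : ℝ} (hβ : 0 ≤ β) (hR : 0 ≤ R) (g : ℕ) :
    0 ≤ digitWeight K β R g := by
  unfold digitWeight; split_ifs <;> positivity

lemma sum_digitWeight_le {K : ℕ} {β R : ℝ} (hβ : 0 ≤ β) (hR : 0 ≤ R) (N : ℕ) :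
    ∑ g ∈ Finset.range N, digitWeight K β R g ≤ (K + 1) * (β * 2 ^ K) + R * (1 / 2) ^ K := by
  have key : ∀ m, ∑ g ∈ Finset.range (K + 1 + m), digitWeight K β R g ≤
      (K + 1) * (β * 2 ^ K) + R * ((1 / 2) ^ K - (1 / 2) ^ (K + m)) := by
    intro m
    induction m with
    | zero =>
      rw [add_zero, add_zero, sub_self, mul_zero, add_zero]
      refine (Finset.sum_congr rfl fun g hg => ?_ : _ = ∑ _g ∈ Finset.range (K + 1),
        β * 2 ^ K).le.trans ?_
      · rw [digitWeight, if_pos (by simpa [Nat.lt_succ_iff] using hg)]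
      · simp
    | succ m ih =>
      rw [← add_assoc, Finset.sum_range_succ]
      have : digitWeight K β R (K + 1 + m) = R * (1 / 2) ^ (K + 1 + m) := by
        rw [digitWeight, if_neg (by omega)]
      rw [this]
      have h2 : (1 / 2 : ℝ) ^ (K + m) = 2 * (1 / 2) ^ (K + 1 + m) := by
        rw [show K + 1 + m = K + m + 1 by ring, pow_succ]; ring
      rw [show K + (m + 1) = K + 1 + m by ring]
      rw [h2] at ih
      linarith
  have h1 : ∑ g ∈ Finset.range N, digitWeight K β R g ≤
      ∑ g ∈ Finset.range (K + 1 + N), digitWeight K β R g :=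
    Finset.sum_le_sum_of_subset_of_nonneg (Finset.range_subset_range.2 (by omega))
      fun g _ _ => digitWeight_nonneg hβ hR g
  have h2 : 0 ≤ R * (1 / 2 : ℝ) ^ (K + N) := by positivity
  linarith [key N, mul_sub R ((1 / 2 : ℝ) ^ K) ((1 / 2) ^ (K + N))]

/-- For digits at distance at most K the discrepancy bound is used, at a loss of 2^K. For distant
digits the trivial bound by the set with the higher digit gains 2^(−g). -/
lemma two_pow_mul_min_le {K i j : ℕ} {β R s t m : ℝ} (hβ : 0 ≤ β) (hR : 0 ≤ R) (hs : 0 ≤ s)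
    (ht : 0 ≤ t) (h1 : m ≤ β * (s + t)) (h2 : m ≤ R * s) (h3 : m ≤ R * t) :
    2 ^ i * 2 ^ j * m ≤ digitWeight K β R (Nat.dist i j) * (4 ^ i * s + 4 ^ j * t) := by
  have h4 : ∀ i : ℕ, (4 : ℝ) ^ i = 2 ^ i * 2 ^ i := fun i => by rw [← mul_pow]; norm_num
  unfold digitWeight
  rcases le_total i j with hij | hij <;> obtain ⟨g, rfl⟩ := Nat.exists_eq_add_of_le hij
  · have hg : Nat.dist i (i + g) = g := by simp [Nat.dist]
    rw [hg]
    split_ifs with hgK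
    · have h5 : (2 : ℝ) ^ g ≤ 2 ^ K := pow_le_pow_right₀ (by norm_num) hgK
      have h6 : (1 : ℝ) ≤ 2 ^ g := one_le_pow₀ (by norm_num)
      calc (2 : ℝ) ^ i * 2 ^ (i + g) * m ≤ 2 ^ i * 2 ^ (i + g) * (β * (s + t)) := by gcongr
        _ = β * (2 ^ g * (4 ^ i * s) + 2 ^ g * (4 ^ i * 1 * t)) := by rw [h4, pow_add]; ring
        _ ≤ β * (2 ^ K * (4 ^ i * s) + 2 ^ K * (4 ^ i * 4 ^ g * t)) := by
            gcongr; exact one_le_pow₀ (by norm_num)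
        _ = _ := by rw [pow_add]; ring
    · calc (2 : ℝ) ^ i * 2 ^ (i + g) * m ≤ 2 ^ i * 2 ^ (i + g) * (R * t) := by gcongr
        _ = R * (1 / 2) ^ g * (4 ^ (i + g) * t) := by
            rw [h4, pow_add, one_div, inv_pow]; field_simp
        _ ≤ _ := by
            gcongr; have : 0 ≤ (4 : ℝ) ^ i * s := by positivity
            linarith
  · have hg : Nat.dist (j + g) j = g := by simp [Nat.dist]
    rw [hg]
    split_ifs with hgK
    · have h5 : (2 : ℝ) ^ g ≤ 2 ^ K := pow_le_pow_right₀ (by norm_num) hgK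
      calc (2 : ℝ) ^ (j + g) * 2 ^ j * m ≤ 2 ^ (j + g) * 2 ^ j * (β * (s + t)) := by gcongr
        _ = β * (2 ^ g * (4 ^ j * 1 * s) + 2 ^ g * (4 ^ j * t)) := by rw [h4, pow_add]; ring
        _ ≤ β * (2 ^ K * (4 ^ j * 4 ^ g * s) + 2 ^ K * (4 ^ j * t)) := by
            gcongr; exact one_le_pow₀ (by norm_num)
        _ = _ := by rw [pow_add]; ring
    · calc (2 : ℝ) ^ (j + g) * 2 ^ j * m ≤ 2 ^ (j + g) * 2 ^ j * (R * s) := by gcongr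
        _ = R * (1 / 2) ^ g * (4 ^ (j + g) * s) := by
            rw [h4, pow_add, one_div, inv_pow]; field_simp
        _ ≤ _ := by
            gcongr; have : 0 ≤ (4 : ℝ) ^ j * t := by positivity
            linarith

variable {ι : Type*} [Fintype ι]

/-- The bound on the bilinear form of a matrix of discrepancy `β` and absolute row and column sums
`R`. -/
def discrepancyBound (K : ℕ) (β R : ℝ) : ℝ := 2 * ((K + 1) * (β * 2 ^ K) + R * (1 / 2) ^ K)

variable {M : ι → ι → ℝ} {β R : ℝ}

/-- Binary digits write x and y as sums of 2^i times indicators of sets, so the form becomes a sum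
over pairs of sets. A Schur-type row-sum estimate over pairs of digits then sums the bounds. -/
lemma abs_bilin_nat_le (hβ : 0 ≤ β) (hR : 0 ≤ R)
    (h1 : ∀ S T : Finset ι, |∑ a ∈ S, ∑ b ∈ T, M a b| ≤ β * (S.card + T.card))
    (h2 : ∀ S T : Finset ι, |∑ a ∈ S, ∑ b ∈ T, M a b| ≤ R * S.card)
    (h3 : ∀ S T : Finset ι, |∑ a ∈ S, ∑ b ∈ T, M a b| ≤ R * T.card) (K : ℕ) (x y : ι → ℕ) :
    |∑ a, ∑ b, M a b * x a * y b| ≤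
      discrepancyBound K β R * (∑ a, (x a : ℝ) ^ 2 + ∑ b, (y b : ℝ) ^ 2) := by
  classical
  choose F hF using exists_binary_digits
  obtain ⟨N, hN⟩ : ∃ N, ∀ z : ι, F (x z) ⊆ Finset.range N ∧ F (y z) ⊆ Finset.range N := by
    let U := Finset.univ.biUnion fun z : ι => F (x z) ∪ F (y z)
    refine ⟨U.sup id + 1, fun z => ⟨fun i hi => ?_, fun i hi => ?_⟩⟩ <;>
    · have : i ∈ U := Finset.mem_biUnion.2 ⟨z, Finset.mem_univ _, by simp [hi]⟩
      have := Finset.le_sup (f := id) this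
      simp at this ⊢; omega
  let S : (ι → ℕ) → ℕ → Finset ι := fun w i => Finset.univ.filter fun a => i ∈ F (w a)
  have hexp : ∀ m, F m ⊆ Finset.range N →
      (m : ℝ) = ∑ i ∈ Finset.range N, if i ∈ F m then 2 ^ i else 0 := by
    intro m hm
    rw [← Finset.sum_filter, Finset.filter_mem_eq_inter, Finset.inter_eq_right.2 hm]
    conv_lhs => rw [← hF m]
    push_cast; rfl
  have hsq : ∀ w : ι → ℕ, (∀ a, F (w a) ⊆ Finset.range N) →
      ∑ i ∈ Finset.range N, (4 : ℝ) ^ i * (S w i).card ≤ ∑ a, (w a : ℝ) ^ 2 := by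
    intro w hw
    have : ∀ i, (4 : ℝ) ^ i * (S w i).card = ∑ a, if i ∈ F (w a) then (4 : ℝ) ^ i else 0 := by
      intro i
      rw [← Finset.sum_filter, Finset.sum_const, nsmul_eq_mul, mul_comm]
    simp only [this]
    rw [Finset.sum_comm]
    refine Finset.sum_le_sum fun a _ => ?_
    rw [← Finset.sum_filter, Finset.filter_mem_eq_inter, Finset.inter_eq_right.2 (hw a)]
    conv_rhs => rw [← hF (w a)]
    push_cast
    -- The squares of the binary parts of an integer sum to at most its square, so no logarithmic
    -- factor is lost.
    have h := Finset.sum_sq_le_sq_sum_of_nonneg (s := F (w a)) (f := fun i => (2 : ℝ) ^ i)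
      fun i _ => by positivity
    refine le_trans (le_of_eq ?_) h
    refine Finset.sum_congr rfl fun i _ => ?_
    rw [← pow_mul, mul_comm, pow_mul]; norm_num
  have hform : ∑ a, ∑ b, M a b * x a * y b =
      ∑ i ∈ Finset.range N, ∑ j ∈ Finset.range N,
        2 ^ i * 2 ^ j * ∑ a ∈ S x i, ∑ b ∈ S y j, M a b := by
    have hterm : ∀ a b, M a b * x a * y b = ∑ i ∈ Finset.range N, ∑ j ∈ Finset.range N,
        2 ^ i * 2 ^ j * (if i ∈ F (x a) then if j ∈ F (y b) then M a b else 0 else 0) := by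
      intro a b
      rw [hexp _ (hN a).1, hexp _ (hN b).2, mul_assoc, Finset.sum_mul_sum, Finset.mul_sum]
      refine Finset.sum_congr rfl fun i _ => ?_
      rw [Finset.mul_sum]
      refine Finset.sum_congr rfl fun j _ => ?_
      split_ifs <;> ring
    calc ∑ a, ∑ b, M a b * x a * y b
        = ∑ a, ∑ i ∈ Finset.range N, ∑ b, ∑ j ∈ Finset.range N,
        2 ^ i * 2 ^ j * (if i ∈ F (x a) then if j ∈ F (y b) then M a b else 0 else 0) := by
          refine Finset.sum_congr rfl fun a _ => ?_
          rw [Finset.sum_comm]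
          exact Finset.sum_congr rfl fun b _ => hterm a b
      _ = ∑ i ∈ Finset.range N, ∑ a, ∑ j ∈ Finset.range N, ∑ b,
        2 ^ i * 2 ^ j * (if i ∈ F (x a) then if j ∈ F (y b) then M a b else 0 else 0) := by
          rw [Finset.sum_comm]
          exact Finset.sum_congr rfl fun i _ => Finset.sum_congr rfl fun a _ => Finset.sum_comm
      _ = _ := by
          refine Finset.sum_congr rfl fun i _ => ?_
          rw [Finset.sum_comm]
          refine Finset.sum_congr rfl fun j _ => ?_
          simp only [← Finset.mul_sum]
          congr 1
          rw [Finset.sum_filter]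
          refine Finset.sum_congr rfl fun a _ => ?_
          split_ifs
          · rw [Finset.sum_filter]
          · simp
  set C := (K + 1) * (β * 2 ^ K) + R * (1 / 2) ^ K with hC
  have hrow : ∀ i, ∑ j ∈ Finset.range N, digitWeight K β R (Nat.dist i j) ≤ 2 * C := fun i =>
    (sum_dist_le (digitWeight_nonneg hβ hR) i).trans
      (mul_le_mul_of_nonneg_left (sum_digitWeight_le hβ hR _) zero_le_two)
  have hC0 : 0 ≤ 2 * C := by positivity
  rw [hform]
  calc |∑ i ∈ Finset.range N, ∑ j ∈ Finset.range N,
        2 ^ i * 2 ^ j * ∑ a ∈ S x i, ∑ b ∈ S y j, M a b|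
      ≤ ∑ i ∈ Finset.range N, ∑ j ∈ Finset.range N,
        2 ^ i * 2 ^ j * |∑ a ∈ S x i, ∑ b ∈ S y j, M a b| := by
        refine (Finset.abs_sum_le_sum_abs _ _).trans (Finset.sum_le_sum fun i _ => ?_)
        refine (Finset.abs_sum_le_sum_abs _ _).trans (Finset.sum_le_sum fun j _ => ?_)
        rw [abs_mul, abs_of_nonneg (by positivity : (0 : ℝ) ≤ 2 ^ i * 2 ^ j)]
    _ ≤ ∑ i ∈ Finset.range N, ∑ j ∈ Finset.range N, digitWeight K β R (Nat.dist i j) *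
          (4 ^ i * (S x i).card + 4 ^ j * (S y j).card) :=
        Finset.sum_le_sum fun i _ => Finset.sum_le_sum fun j _ =>
          two_pow_mul_min_le hβ hR (by positivity) (by positivity) (h1 _ _) (h2 _ _) (h3 _ _)
    _ = ∑ i ∈ Finset.range N, (∑ j ∈ Finset.range N, digitWeight K β R (Nat.dist i j)) *
          (4 ^ i * (S x i).card) +
        ∑ j ∈ Finset.range N, (∑ i ∈ Finset.range N, digitWeight K β R (Nat.dist j i)) *
          (4 ^ j * (S y j).card) := by
        simp only [mul_add, Finset.sum_add_distrib, Finset.sum_mul]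
        congr 1
        rw [Finset.sum_comm]
        exact Finset.sum_congr rfl fun i _ => Finset.sum_congr rfl fun j _ => by
          rw [Nat.dist_comm]
    _ ≤ ∑ i ∈ Finset.range N, 2 * C * (4 ^ i * (S x i).card) +
        ∑ j ∈ Finset.range N, 2 * C * (4 ^ j * (S y j).card) := by
        gcongr with i _ j _
        · exact hrow i
        · exact hrow j
    _ = 2 * C * (∑ i ∈ Finset.range N, 4 ^ i * ((S x i).card : ℝ) +
          ∑ j ∈ Finset.range N, 4 ^ j * ((S y j).card : ℝ)) := by
        rw [← Finset.mul_sum, ← Finset.mul_sum, ← mul_add]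
    _ ≤ 2 * C * (∑ a, (x a : ℝ) ^ 2 + ∑ b, (y b : ℝ) ^ 2) := by
        gcongr
        · exact hsq x fun a => (hN a).1
        · exact hsq y fun a => (hN a).2

/-- Both sides are homogeneous of degree two: approximate by ⌊x m⌋ / m and let m grow. -/
lemma abs_bilin_nonneg_le (hβ : 0 ≤ β) (hR : 0 ≤ R)
    (h1 : ∀ S T : Finset ι, |∑ a ∈ S, ∑ b ∈ T, M a b| ≤ β * (S.card + T.card))
    (h2 : ∀ S T : Finset ι, |∑ a ∈ S, ∑ b ∈ T, M a b| ≤ R * S.card)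
    (h3 : ∀ S T : Finset ι, |∑ a ∈ S, ∑ b ∈ T, M a b| ≤ R * T.card) (K : ℕ) {x y : ι → ℝ}
    (hx : ∀ a, 0 ≤ x a) (hy : ∀ a, 0 ≤ y a) :
    |∑ a, ∑ b, M a b * x a * y b| ≤
      discrepancyBound K β R * (∑ a, x a ^ 2 + ∑ b, y b ^ 2) := by
  have hlim : ∀ z : ℝ, 0 ≤ z →
      Filter.Tendsto (fun m : ℕ => (⌊z * m⌋₊ : ℝ) / m) Filter.atTop (nhds z) := fun z hz =>
    (tendsto_nat_floor_mul_div_atTop hz).comp tendsto_natCast_atTop_atTop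
  have hL : Filter.Tendsto
      (fun m : ℕ => |∑ a, ∑ b, M a b * ((⌊x a * m⌋₊ : ℝ) / m) * ((⌊y b * m⌋₊ : ℝ) / m)|)
      Filter.atTop (nhds |∑ a, ∑ b, M a b * x a * y b|) := by
    refine (tendsto_finsetSum _ fun a _ => tendsto_finsetSum _ fun b _ => ?_).abs
    exact ((hlim _ (hx a)).const_mul _).mul (hlim _ (hy b))
  have hRt : Filter.Tendsto
      (fun m : ℕ => discrepancyBound K β R *
        (∑ a, ((⌊x a * m⌋₊ : ℝ) / m) ^ 2 + ∑ b, ((⌊y b * m⌋₊ : ℝ) / m) ^ 2))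
      Filter.atTop (nhds (discrepancyBound K β R * (∑ a, x a ^ 2 + ∑ b, y b ^ 2))) := by
    refine Filter.Tendsto.const_mul _ (Filter.Tendsto.add ?_ ?_)
    · exact tendsto_finsetSum _ fun a _ => (hlim _ (hx a)).pow 2
    · exact tendsto_finsetSum _ fun a _ => (hlim _ (hy a)).pow 2
  refine le_of_tendsto_of_tendsto hL hRt ?_
  filter_upwards [Filter.eventually_gt_atTop 0] with m hm
  have hm' : (0 : ℝ) < m := by exact_mod_cast hm
  have h := abs_bilin_nat_le hβ hR h1 h2 h3 K (fun a => ⌊x a * m⌋₊) (fun a => ⌊y a * m⌋₊)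
  have e1 : ∑ a, ∑ b, M a b * ((⌊x a * m⌋₊ : ℝ) / m) * ((⌊y b * m⌋₊ : ℝ) / m) =
      (∑ a, ∑ b, M a b * (⌊x a * m⌋₊ : ℝ) * (⌊y b * m⌋₊ : ℝ)) / m ^ 2 := by
    simp only [Finset.sum_div]
    exact Finset.sum_congr rfl fun a _ => Finset.sum_congr rfl fun b _ => by field_simp
  rw [e1, abs_div, abs_of_pos (by positivity : (0 : ℝ) < (m : ℝ) ^ 2)]
  simp only [div_pow, ← Finset.sum_div, ← add_div, ← mul_div_assoc]
  gcongr

/-- Splitting x into positive and negative parts gives four nonnegative forms, whence the factor 4.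
-/
lemma abs_quadratic_le (hβ : 0 ≤ β) (hR : 0 ≤ R)
    (h1 : ∀ S T : Finset ι, |∑ a ∈ S, ∑ b ∈ T, M a b| ≤ β * (S.card + T.card))
    (h2 : ∀ S T : Finset ι, |∑ a ∈ S, ∑ b ∈ T, M a b| ≤ R * S.card)
    (h3 : ∀ S T : Finset ι, |∑ a ∈ S, ∑ b ∈ T, M a b| ≤ R * T.card) (K : ℕ) (x : ι → ℝ) :
    |∑ a, ∑ b, M a b * x a * x b| ≤ 4 * discrepancyBound K β R * ∑ a, x a ^ 2 := by
  set u : ι → ℝ := fun a => max (x a) 0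
  set v : ι → ℝ := fun a => max (-x a) 0
  have hu : ∀ a, 0 ≤ u a := fun a => le_max_right _ _
  have hv : ∀ a, 0 ≤ v a := fun a => le_max_right _ _
  have hxu : ∀ a, x a = u a - v a := fun a => by
    rcases le_total 0 (x a) with h | h <;> simp [u, v, h]
  have hsq : ∀ a, x a ^ 2 = u a ^ 2 + v a ^ 2 := fun a => by
    rcases le_total 0 (x a) with h | h <;> simp [u, v, h]
  have hB := fun {y z : ι → ℝ} => abs_bilin_nonneg_le (x := y) (y := z) hβ hR h1 h2 h3 K
  have huu := hB hu hu
  have huv := hB hu hv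
  have hvu := hB hv hu
  have hvv := hB hv hv
  have e : ∑ a, ∑ b, M a b * x a * x b = ∑ a, ∑ b, M a b * u a * u b -
      ∑ a, ∑ b, M a b * u a * v b - ∑ a, ∑ b, M a b * v a * u b +
      ∑ a, ∑ b, M a b * v a * v b := by
    simp only [← Finset.sum_sub_distrib, ← Finset.sum_add_distrib]
    refine Finset.sum_congr rfl fun a _ => Finset.sum_congr rfl fun b _ => ?_
    rw [hxu a, hxu b]; ring
  rw [e]
  simp only [hsq, Finset.sum_add_distrib]
  rw [abs_le] at *
  constructor <;> nlinarith

end Discrepancy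

/-! ### Bernstein-type tail bound and conditioning on an independent variable -/

section Concentration

variable {Ω : Type*} [MeasurableSpace Ω] {μ : Measure Ω} [IsProbabilityMeasure μ]

lemma exp_le_of_abs_le_one {x : ℝ} (hx : |x| ≤ 1) : Real.exp x ≤ 1 + x + x ^ 2 := by
  have := (abs_le.1 (Real.abs_exp_sub_one_sub_id_le hx)).2
  linarith

lemma integrable_of_mem_Icc {X : Ω → ℝ} (hX : AEMeasurable X μ) (h0 : ∀ ω, 0 ≤ X ω)
    (h1 : ∀ ω, X ω ≤ 1) : Integrable X μ :=
  Integrable.of_bound hX.aestronglyMeasurable 1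
    (Filter.Eventually.of_forall fun ω => by simpa [abs_of_nonneg (h0 ω)] using h1 ω)

/-- Expand by e^x ≤ 1 + x + x²; since X² ≤ X on [0, 1], the variance is at most the mean. -/
lemma integral_exp_centered_le {X : Ω → ℝ} (hX : AEMeasurable X μ) (h0 : ∀ ω, 0 ≤ X ω)
    (h1 : ∀ ω, X ω ≤ 1) {c : ℝ} (hc : |c| ≤ 1) :
    ∫ ω, Real.exp (c * (X ω - μ[X])) ∂μ ≤ Real.exp (c ^ 2 * μ[X]) := by
  have hint := integrable_of_mem_Icc hX h0 h1
  set q := μ[X] with hq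
  have hq0 : 0 ≤ q := integral_nonneg h0
  have hq1 : q ≤ 1 := by
    have := integral_mono hint (integrable_const 1) h1
    simpa using this
  have hpt : ∀ ω, Real.exp (c * (X ω - q)) ≤
      (1 - c * q + c ^ 2 * q ^ 2) + (c + c ^ 2 * (1 - 2 * q)) * X ω := by
    intro ω
    have hb : |c * (X ω - q)| ≤ 1 := by
      rw [abs_mul]
      have : |X ω - q| ≤ 1 := abs_le.2 ⟨by linarith [h0 ω], by linarith [h1 ω]⟩
      nlinarith [abs_nonneg c, abs_nonneg (X ω - q)]
    refine (exp_le_of_abs_le_one hb).trans ?_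
    have : 0 ≤ c ^ 2 * (X ω * (1 - X ω)) :=
      mul_nonneg (sq_nonneg _) (mul_nonneg (h0 ω) (by linarith [h1 ω]))
    nlinarith
  have hexpint : Integrable (fun ω => Real.exp (c * (X ω - q))) μ := by
    refine Integrable.of_bound (C := Real.exp 1) ?_ (Filter.Eventually.of_forall fun ω => ?_)
    · exact (Real.measurable_exp.comp_aemeasurable
        ((hX.sub_const q).const_mul c)).aestronglyMeasurable
    · rw [Real.norm_eq_abs, abs_of_pos (Real.exp_pos _), Real.exp_le_exp]
      refine (le_abs_self _).trans ?_
      rw [abs_mul]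
      have : |X ω - q| ≤ 1 := abs_le.2 ⟨by linarith [h0 ω], by linarith [h1 ω]⟩
      nlinarith [abs_nonneg c, abs_nonneg (X ω - q)]
  calc ∫ ω, Real.exp (c * (X ω - q)) ∂μ
      ≤ ∫ ω, ((1 - c * q + c ^ 2 * q ^ 2) + (c + c ^ 2 * (1 - 2 * q)) * X ω) ∂μ :=
        integral_mono hexpint ((integrable_const _).add (hint.const_mul _)) hpt
    _ = 1 + c ^ 2 * q * (1 - q) := by
        rw [integral_add (integrable_const _) (hint.const_mul _), integral_const_mul, ← hq]
        simp; ring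
    _ ≤ c ^ 2 * q + 1 := by nlinarith [mul_nonneg (sq_nonneg c) (sq_nonneg q)]
    _ ≤ _ := Real.add_one_le_exp _

variable {κ : Type*} [Fintype κ] {X : κ → Ω → ℝ}

/-- Chernoff's bound at parameter 1: the free parameter is the scale of the weights c, chosen in
each application. -/
lemma measureReal_sum_centered_ge_le (hX : iIndepFun X μ) (hm : ∀ i, AEMeasurable (X i) μ)
    (h0 : ∀ i ω, 0 ≤ X i ω) (h1 : ∀ i ω, X i ω ≤ 1) {c : κ → ℝ} (hc : ∀ i, |c i| ≤ 1) (t : ℝ) :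
    μ.real {ω | t ≤ ∑ i, c i * (X i ω - μ[X i])} ≤
      Real.exp (∑ i, c i ^ 2 * μ[X i] - t) := by
  have hS : AEMeasurable (fun ω => ∑ i, c i * (X i ω - μ[X i])) μ :=
    Finset.aemeasurable_fun_sum _ fun i _ => ((hm i).sub_const _).const_mul _
  have hint : Integrable (fun ω => Real.exp (1 * ∑ i, c i * (X i ω - μ[X i]))) μ := by
    refine Integrable.of_bound (C := Real.exp (Fintype.card κ)) ?_
      (Filter.Eventually.of_forall fun ω => ?_)
    · exact (Real.measurable_exp.comp_aemeasurable (hS.const_mul 1)).aestronglyMeasurable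
    · rw [Real.norm_eq_abs, abs_of_pos (Real.exp_pos _), Real.exp_le_exp, one_mul]
      calc ∑ i, c i * (X i ω - μ[X i]) ≤ ∑ _i : κ, (1 : ℝ) := by
            refine Finset.sum_le_sum fun i _ => (le_abs_self _).trans ?_
            have hq0 : 0 ≤ μ[X i] := integral_nonneg (h0 i)
            have hq1 : μ[X i] ≤ 1 := by
              have := integral_mono (integrable_of_mem_Icc (hm i) (h0 i) (h1 i))
                (integrable_const 1) (h1 i)
              simpa using this
            have : |X i ω - μ[X i]| ≤ 1 :=
              abs_le.2 ⟨by linarith [h0 i ω], by linarith [h1 i ω]⟩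
            rw [abs_mul]
            nlinarith [abs_nonneg (c i), abs_nonneg (X i ω - μ[X i]), hc i]
        _ = Fintype.card κ := by simp
  refine (measure_ge_le_exp_mul_mgf t zero_le_one hint).trans ?_
  have hmgf : mgf (fun ω => ∑ i, c i * (X i ω - μ[X i])) μ 1 ≤
      Real.exp (∑ i, c i ^ 2 * μ[X i]) := by
    simp only [mgf, one_mul, Real.exp_sum]
    rw [hX.integral_fun_prod_comp (f := fun i x => Real.exp (c i * (x - μ[X i]))) hm
      fun i => by fun_prop]
    exact Finset.prod_le_prod (fun i _ => integral_nonneg fun ω => (Real.exp_pos _).le)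
      fun i _ => integral_exp_centered_le (hm i) (h0 i) (h1 i) (hc i)
  calc Real.exp (-1 * t) * mgf (fun ω => ∑ i, c i * (X i ω - μ[X i])) μ 1
      ≤ Real.exp (-1 * t) * Real.exp (∑ i, c i ^ 2 * μ[X i]) := by gcongr
    _ = _ := by rw [← Real.exp_add]; congr 1; ring

/-- A Bernstein-type inequality for weighted sums of independent variables in `[0, 1]`. -/
theorem measureReal_abs_sum_centered_ge_le (hX : iIndepFun X μ) (hm : ∀ i, AEMeasurable (X i) μ)
    (h0 : ∀ i ω, 0 ≤ X i ω) (h1 : ∀ i ω, X i ω ≤ 1) {c : κ → ℝ} (hc : ∀ i, |c i| ≤ 1) (t : ℝ) :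
    μ.real {ω | t ≤ |∑ i, c i * (X i ω - μ[X i])|} ≤
      2 * Real.exp (∑ i, c i ^ 2 * μ[X i] - t) := by
  have hp := measureReal_sum_centered_ge_le hX hm h0 h1 hc t
  have hn := measureReal_sum_centered_ge_le hX hm h0 h1 (c := fun i => -c i) (by simpa using hc) t
  simp only [neg_mul, Finset.sum_neg_distrib, neg_sq] at hn
  have hsub : {ω | t ≤ |∑ i, c i * (X i ω - μ[X i])|} ⊆
      {ω | t ≤ ∑ i, c i * (X i ω - μ[X i])} ∪ {ω | t ≤ -∑ i, c i * (X i ω - μ[X i])} :=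
    fun ω hω => by simpa [le_abs] using hω
  have := (measureReal_mono hsub (measure_ne_top μ _)).trans (measureReal_union_le _ _)
  linarith

/-- Fubini: Y may be frozen at each value. Countability of both ranges makes every predicate B
measurable, so nothing has to be checked for the leave-one-out vector. -/
lemma measureReal_le_of_indepFun {β γ : Type*} [MeasurableSpace β] [MeasurableSpace γ]
    [Countable β] [Countable γ] [MeasurableSingletonClass β] [MeasurableSingletonClass γ]
    {X : Ω → β} {Y : Ω → γ} (hX : AEMeasurable X μ) (hY : AEMeasurable Y μ)
    (hXY : IndepFun X Y μ) {B : β → γ → Prop} {q : ℝ}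
    (h : ∀ y, μ.real {ω | B (X ω) y} ≤ q) : μ.real {ω | B (X ω) (Y ω)} ≤ q := by
  have : IsProbabilityMeasure (μ.map X) := Measure.isProbabilityMeasure_map hX
  have : IsProbabilityMeasure (μ.map Y) := Measure.isProbabilityMeasure_map hY
  let S : Set (β × γ) := {w | B w.1 w.2}
  have hS : MeasurableSet S := S.to_countable.measurableSet
  have hq : 0 ≤ q ∨ IsEmpty γ := by
    rcases isEmpty_or_nonempty γ with h' | ⟨⟨y⟩⟩
    · exact Or.inr h'
    · exact Or.inl (measureReal_nonneg.trans (h y))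
  rcases hq with hq | hγ
  swap
  · have : IsEmpty Ω := ⟨fun ω => hγ.false (Y ω)⟩
    have h1 := measure_univ (μ := μ)
    rw [Set.univ_eq_empty_iff.2 this, measure_empty] at h1
    exact absurd h1 zero_ne_one
  have h1 : μ {ω | B (X ω) (Y ω)} = (μ.map X).prod (μ.map Y) S := by
    rw [← hXY.map_prod_eq_prod_map_map hX hY, Measure.map_apply_of_aemeasurable (hX.prodMk hY) hS]
    rfl
  have h2 : μ {ω | B (X ω) (Y ω)} ≤ ENNReal.ofReal q := by
    rw [h1, Measure.prod_apply_symm hS]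
    calc ∫⁻ y, μ.map X ((fun x => (x, y)) ⁻¹' S) ∂μ.map Y
        ≤ ∫⁻ _y, ENNReal.ofReal q ∂μ.map Y := by
          refine lintegral_mono fun y => ?_
          rw [Measure.map_apply_of_aemeasurable hX (Set.to_countable _).measurableSet,
            ← ofReal_measureReal]
          exact ENNReal.ofReal_le_ofReal (h y)
      _ = ENNReal.ofReal q := by simp
  exact ENNReal.toReal_le_of_le_ofReal hq h2

lemma iIndepFun_map_iff {Ω' κ : Type*} [Fintype κ] [MeasurableSpace Ω'] {G : Ω → Ω'}
    {β : κ → Type*} [∀ i, MeasurableSpace (β i)] {f : ∀ i, Ω' → β i} (hG : AEMeasurable G μ)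
    (hf : ∀ i, Measurable (f i)) :
    iIndepFun f (μ.map G) ↔ iIndepFun (fun i ω => f i (G ω)) μ := by
  have : IsProbabilityMeasure (μ.map G) := Measure.isProbabilityMeasure_map hG
  rw [iIndepFun_iff_map_fun_eq_pi_map fun i => (hf i).aemeasurable,
    iIndepFun_iff_map_fun_eq_pi_map (f := fun i ω => f i (G ω))
      fun i => (hf i).comp_aemeasurable hG,
    AEMeasurable.map_map_of_aemeasurable (measurable_pi_lambda _ hf).aemeasurable hG]
  have : ∀ i, (μ.map G).map (f i) = μ.map fun ω => f i (G ω) := fun i =>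
    AEMeasurable.map_map_of_aemeasurable (hf i).aemeasurable hG
  simp only [this]
  rfl

end Concentration

/-! ### Independence of the edges of the random graph -/

section RandomGraph

variable {n : ℕ}

/-- The indicators of the edges of a graph. -/
def edges (g : SimpleGraph (Fin n)) : Pair n → Prop := fun e => g.Adj e.1.1 e.1.2

lemma measurable_edges (e : Pair n) : Measurable fun g : SimpleGraph (Fin n) => edges g e := by
  unfold edges; fun_prop

-- The random graph is the image of a product measure on unordered pairs, and the edge indicators
-- are distinct coordinates of it off the diagonal.
open Measure in
lemma iIndepFun_edges_binomialRandom (p : unitInterval) :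
    iIndepFun (fun (e : Pair n) g => edges g e) (SimpleGraph.binomialRandom (Fin n) p) ∧
    ∀ e : Pair n, (SimpleGraph.binomialRandom (Fin n) p).real {g | edges g e} = p := by
  let ν : Sym2 (Fin n) → Measure Prop := fun e =>
    unitInterval.toNNReal p • dirac (e ∈ (Sym2.diagSetᶜ : Set (Sym2 (Fin n)))) +
      unitInterval.toNNReal (unitInterval.symm p) • dirac False
  have hν : ∀ e, IsProbabilityMeasure (ν e) := fun e => by infer_instance
  let Γ : (Sym2 (Fin n) → Prop) → SimpleGraph (Fin n) := fun ω =>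
    SimpleGraph.fromEdgeSet {i | ω i}
  have hset : Measurable fun ω : Sym2 (Fin n) → Prop => {i | ω i} :=
    MeasurableEquiv.setOfPred.measurable
  have hΓ : Measurable Γ := SimpleGraph.measurable_fromEdgeSet.comp hset
  have hlaw : SimpleGraph.binomialRandom (Fin n) p = (infinitePi ν).map Γ := by
    rw [SimpleGraph.binomialRandom_eq_map, setBernoulli_eq_map,
      Measure.map_map SimpleGraph.measurable_fromEdgeSet hset]
    rfl
  have hedge : ∀ (e : Pair n) ω, edges (Γ ω) e = ω s(e.1.1, e.1.2) := by
    intro e ω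
    simp [edges, Γ, SimpleGraph.fromEdgeSet_adj, e.2.ne]
  have hinj : Function.Injective fun e : Pair n => s(e.1.1, e.1.2) := by
    rintro ⟨⟨a, b⟩, hab⟩ ⟨⟨c, d⟩, hcd⟩ h
    simp only [Sym2.eq_iff] at h
    rcases h with ⟨rfl, rfl⟩ | ⟨rfl, rfl⟩
    · rfl
    · exact absurd hab hcd.not_gt
  refine ⟨?_, fun e => ?_⟩
  · rw [hlaw, iIndepFun_map_iff hΓ.aemeasurable measurable_edges]
    simp only [hedge]
    exact (iIndepFun_infinitePi (P := ν) (X := fun _ => id) fun _ => measurable_id).precomp hinj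
  · have hs : MeasurableSet {g : SimpleGraph (Fin n) | edges g e} :=
      measurableSet_setOfPred.2 (measurable_edges e)
    rw [hlaw, map_measureReal_apply hΓ hs]
    have h1 : Γ ⁻¹' {g | edges g e} = (fun ω => ω s(e.1.1, e.1.2)) ⁻¹' {True} := by
      ext ω
      have := hedge e ω
      simp_all
    rw [h1, ← map_measureReal_apply (measurable_pi_apply _) (MeasurableSet.singleton _),
      infinitePi_map_eval]
    simp [ν, measureReal_def, e.2.ne]

end RandomGraph

/-! ### Sums over ordered and unordered pairs -/

section Pairs

variable {n : ℕ}

lemma sum_sum_eq_sum_pair {F : Fin n → Fin n → ℝ} (hF : ∀ a, F a a = 0) :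
    ∑ a, ∑ b, F a b = ∑ e : Pair n, (F e.1.1 e.1.2 + F e.1.2 e.1.1) := by
  have h1 : ∀ f : Fin n × Fin n → ℝ,
      ∑ x : Fin n × Fin n, (if x.1 < x.2 then f x else 0) = ∑ e : Pair n, f e.1 := by
    intro f
    rw [← Finset.sum_filter]
    exact Finset.sum_subtype _ (by simp) f
  have h2 : ∑ x : Fin n × Fin n, (if x.2 < x.1 then F x.1 x.2 else 0) =
      ∑ e : Pair n, F e.1.2 e.1.1 := by
    rw [← h1 fun x => F x.2 x.1]
    exact Fintype.sum_equiv (Equiv.prodComm _ _) _ _ fun x => rfl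
  rw [Finset.sum_add_distrib, ← h1 fun x => F x.1 x.2, ← h2, ← Finset.sum_add_distrib,
    ← Fintype.sum_prod_type']
  refine Finset.sum_congr rfl fun x _ => ?_
  obtain ⟨a, b⟩ := x
  rcases lt_trichotomy a b with h | h | h
  · simp [h, h.not_gt]
  · subst h; simp [hF]
  · simp [h, h.not_gt]

/-- The sum of a function over one row of a matrix, as a sum over the matrix. -/
lemma sum_row_eq {l : Fin n} (f : Fin n → Fin n → ℝ) (w : Fin n → ℝ) :
    ∑ a, ∑ b, (if a = l then w b else 0) * f a b = ∑ b, w b * f l b := by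
  rw [Finset.sum_eq_single l]
  · simp
  · intro a _ ha; simp [ha]
  · simp

lemma sum_row_sq_eq {l : Fin n} (w : Fin n → ℝ) :
    ∑ a, ∑ b, (if a = l then w b else 0) ^ 2 = ∑ b, w b ^ 2 := by
  rw [Finset.sum_eq_single l]
  · simp
  · intro a _ ha; simp [ha]
  · simp

lemma sum_pair_sq_le (w : Fin n → Fin n → ℝ) :
    ∑ e : Pair n, (w e.1.1 e.1.2 ^ 2 + w e.1.2 e.1.1 ^ 2) ≤ ∑ a, ∑ b, w a b ^ 2 := by
  classical
  have h := sum_sum_eq_sum_pair (F := fun a b => if a = b then 0 else w a b ^ 2) (by simp)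
  have h' : ∑ e : Pair n, (w e.1.1 e.1.2 ^ 2 + w e.1.2 e.1.1 ^ 2) =
      ∑ a, ∑ b, if a = b then 0 else w a b ^ 2 := by
    rw [h]
    exact Finset.sum_congr rfl fun e _ => by simp [e.2.ne, e.2.ne']
  rw [h']
  refine Finset.sum_le_sum fun a _ => Finset.sum_le_sum fun b _ => ?_
  split_ifs
  · positivity
  · exact le_rfl

open Classical in
/-- The adjacency matrix of the graph with edge indicators `s`. -/
def edgeWeight (s : Pair n → Prop) (a b : Fin n) : ℝ :=
  if h : a < b then (if s ⟨(a, b), h⟩ then 1 else 0)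
  else if h : b < a then (if s ⟨(b, a), h⟩ then 1 else 0) else 0

open Classical in
lemma edgeWeight_pair (s : Pair n → Prop) (e : Pair n) :
    edgeWeight s e.1.1 e.1.2 = if s e then 1 else 0 := by
  rw [edgeWeight, dif_pos e.2]

lemma edgeWeight_comm (s : Pair n → Prop) (a b : Fin n) :
    edgeWeight s a b = edgeWeight s b a := by
  unfold edgeWeight
  rcases lt_trichotomy a b with h | h | h
  · simp [h, h.not_gt]
  · subst h; rfl
  · simp [h, h.not_gt]

lemma edgeWeight_self (s : Pair n → Prop) (a : Fin n) : edgeWeight s a a = 0 := by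
  simp [edgeWeight]

lemma edgeWeight_zero_or_one (s : Pair n → Prop) (a b : Fin n) :
    edgeWeight s a b = 0 ∨ edgeWeight s a b = 1 := by
  unfold edgeWeight
  split_ifs <;> simp

open Classical in
lemma edgeWeight_edges (g : SimpleGraph (Fin n)) (a b : Fin n) :
    edgeWeight (edges g) a b = if g.Adj a b then 1 else 0 := by
  unfold edgeWeight edges
  rcases lt_trichotomy a b with h | h | h
  · simp [h]
  · subst h; simp
  · simp [h, h.not_gt, g.adj_comm]

lemma edgeWeight_congr {s s' : Pair n → Prop} {a b : Fin n}
    (h : ∀ e : Pair n, (e.1 = (a, b) ∨ e.1 = (b, a)) → (s e ↔ s' e)) :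
    edgeWeight s a b = edgeWeight s' a b := by
  unfold edgeWeight
  split_ifs with h1 h2 h3 h4 <;> simp_all

end Pairs

/-! ### Concentration of the adjacency matrix -/

section GraphConcentration

variable {n : ℕ} {Ω : Type*} [MeasurableSpace Ω] {μ : Measure Ω} [IsProbabilityMeasure μ]
  {E : Ω → Pair n → Prop} {p : ℝ}

/-- The indicators `E` are independent with probability `p`. -/
structure IsBernoulliEdges (p : ℝ) (E : Ω → Pair n → Prop) (μ : Measure Ω) : Prop where
  indep : iIndepFun (fun e ω => E ω e) μ
  aemeasurable : ∀ e, AEMeasurable (fun ω => E ω e) μ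
  prob : ∀ e, μ.real {ω | E ω e} = p

/-- The deviation of the adjacency matrix from its mean. -/
def edgeDeviation (p : ℝ) (s : Pair n → Prop) (a b : Fin n) : ℝ :=
  edgeWeight s a b - if a = b then 0 else p

open Classical in
lemma integral_ite_eq {Ω : Type*} [MeasurableSpace Ω] {μ : Measure Ω}
    {s : Ω → Prop} (hs : AEMeasurable s μ) :
    ∫ ω, (if s ω then (1 : ℝ) else 0) ∂μ = μ.real {ω | s ω} := by
  have hn : NullMeasurableSet {ω | s ω} μ := by
    have : {ω | s ω} = s ⁻¹' {True} := by ext; simp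
    rw [this]
    exact hs.nullMeasurableSet_preimage (MeasurableSet.singleton _)
  calc ∫ ω, (if s ω then (1 : ℝ) else 0) ∂μ = ∫ ω, {ω | s ω}.indicator (fun _ => (1 : ℝ)) ω ∂μ :=
        integral_congr_ae (Filter.Eventually.of_forall fun ω => by
          by_cases h : s ω <;> simp [h])
    _ = μ.real {ω | s ω} := by rw [integral_indicator₀ hn]; simp

/-- Each edge carries the coefficient w a b + w b a, so weights up to 1/2 are allowed and the
variance term doubles. -/
theorem measureReal_edgeDeviation_ge_le (hE : IsBernoulliEdges p E μ) (hp : 0 ≤ p)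
    {w : Fin n → Fin n → ℝ} (hw : ∀ a b, |w a b| ≤ 1 / 2) (t : ℝ) :
    μ.real {ω | t ≤ |∑ a, ∑ b, w a b * edgeDeviation p (E ω) a b|} ≤
      2 * Real.exp (2 * p * ∑ a, ∑ b, w a b ^ 2 - t) := by
  classical
  let X : Pair n → Ω → ℝ := fun e ω => if E ω e then 1 else 0
  have hmeas : Measurable fun q : Prop => if q then (1 : ℝ) else 0 := measurable_from_top
  have hX : iIndepFun X μ := hE.indep.comp (fun _ q => if q then (1 : ℝ) else 0) fun _ => hmeas
  have hm : ∀ e, AEMeasurable (X e) μ := fun e => hmeas.comp_aemeasurable (hE.aemeasurable e)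
  have hq : ∀ e, μ[X e] = p := fun e => by
    rw [← hE.prob e]; exact integral_ite_eq (hE.aemeasurable e)
  have h := measureReal_abs_sum_centered_ge_le hX hm
    (fun e ω => by simp only [X]; split_ifs <;> simp)
    (fun e ω => by simp only [X]; split_ifs <;> simp)
    (c := fun e => w e.1.1 e.1.2 + w e.1.2 e.1.1) (fun e => by
      have := abs_add_le (w e.1.1 e.1.2) (w e.1.2 e.1.1)
      linarith [hw e.1.1 e.1.2, hw e.1.2 e.1.1]) t
  simp only [hq] at h
  have e1 : ∀ ω, ∑ a, ∑ b, w a b * edgeDeviation p (E ω) a b =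
      ∑ e : Pair n, (w e.1.1 e.1.2 + w e.1.2 e.1.1) * (X e ω - p) := by
    intro ω
    rw [sum_sum_eq_sum_pair (by simp [edgeDeviation, edgeWeight_self])]
    refine Finset.sum_congr rfl fun e _ => ?_
    rw [edgeDeviation, edgeDeviation, edgeWeight_comm _ e.1.2 e.1.1, edgeWeight_pair,
      if_neg e.2.ne, if_neg e.2.ne']
    ring
  simp only [e1]
  refine h.trans ?_
  gcongr
  rw [← Finset.sum_mul]
  have h2 : ∑ e : Pair n, (w e.1.1 e.1.2 + w e.1.2 e.1.1) ^ 2 ≤ 2 * ∑ a, ∑ b, w a b ^ 2 := by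
    refine le_trans ?_ (mul_le_mul_of_nonneg_left (sum_pair_sq_le w) zero_le_two)
    rw [Finset.mul_sum]
    refine Finset.sum_le_sum fun e _ => ?_
    nlinarith [sq_nonneg (w e.1.1 e.1.2 - w e.1.2 e.1.1)]
  nlinarith

/-- With weight al/8 on S × T, the bound |S||T| ≤ n(|S| + |T|) leaves the exponent al²/8 − al²/32 =
3al²/32 per element. The geometric form in |S| + |T| is what the union bound sums. -/
lemma measureReal_discrepancy_le (hE : IsBernoulliEdges p E μ) (hp : 0 ≤ p) {al : ℝ}
    (hal : 0 < al) (hal4 : al ≤ 4) (S T : Finset (Fin n)) :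
    μ.real {ω | al * (n * p) * (S.card + T.card) <
      |∑ a ∈ S, ∑ b ∈ T, edgeDeviation p (E ω) a b|} ≤
      2 * Real.exp (-(3 * al ^ 2 / 32 * (n * p))) ^ (S.card + T.card) := by
  classical
  set w : Fin n → Fin n → ℝ := fun a b => if a ∈ S ∧ b ∈ T then al / 8 else 0 with hw
  have hwle : ∀ a b, |w a b| ≤ 1 / 2 := by
    intro a b
    simp only [hw]
    split_ifs
    · rw [abs_of_pos (by positivity)]; linarith
    · simp
  have h := measureReal_edgeDeviation_ge_le hE hp hwle
    (al / 8 * (al * (n * p) * (S.card + T.card)))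
  have e1 : ∀ f : Fin n → Fin n → ℝ, ∑ a, ∑ b, (if a ∈ S ∧ b ∈ T then f a b else 0) =
      ∑ a ∈ S, ∑ b ∈ T, f a b := by
    intro f
    have h' : ∀ a, ∑ b, (if a ∈ S ∧ b ∈ T then f a b else 0) =
        if a ∈ S then ∑ b ∈ T, f a b else 0 := by
      intro a
      by_cases ha : a ∈ S <;> simp [ha]
    simp [h']
  have e2 : ∀ ω, ∑ a, ∑ b, w a b * edgeDeviation p (E ω) a b =
      al / 8 * ∑ a ∈ S, ∑ b ∈ T, edgeDeviation p (E ω) a b := by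
    intro ω
    rw [← e1]
    simp only [Finset.mul_sum, hw]
    refine Finset.sum_congr rfl fun a _ => Finset.sum_congr rfl fun b _ => ?_
    split_ifs <;> simp
  have e3 : ∑ a, ∑ b, w a b ^ 2 = (al / 8) ^ 2 * (S.card * T.card) := by
    have : ∀ a b, w a b ^ 2 = if a ∈ S ∧ b ∈ T then (al / 8) ^ 2 else 0 := by
      intro a b; simp only [hw]; split_ifs <;> simp
    simp only [this]
    rw [e1 fun _ _ => (al / 8) ^ 2]
    simp; ring
  have hsub : {ω | al * (n * p) * (S.card + T.card) <
      |∑ a ∈ S, ∑ b ∈ T, edgeDeviation p (E ω) a b|} ⊆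
      {ω | al / 8 * (al * (n * p) * (S.card + T.card)) ≤
        |∑ a, ∑ b, w a b * edgeDeviation p (E ω) a b|} := by
    intro ω hω
    simp only [Set.mem_ofPred_eq] at hω ⊢
    rw [e2, abs_mul, abs_of_pos (by positivity : 0 < al / 8)]
    gcongr
  refine (measureReal_mono hsub (measure_ne_top μ _)).trans (h.trans ?_)
  rw [← Real.exp_nat_mul, e3]
  gcongr
  push_cast
  have hS : (S.card : ℝ) ≤ n := by exact_mod_cast (card_finset_fin_le S)
  have hT : (T.card : ℝ) ≤ n := by exact_mod_cast (card_finset_fin_le T)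
  have hST : (S.card : ℝ) * T.card ≤ n * (S.card + T.card) := by
    nlinarith [(Nat.cast_nonneg S.card : (0 : ℝ) ≤ _), (Nat.cast_nonneg T.card : (0 : ℝ) ≤ _)]
  have := mul_le_mul_of_nonneg_left hST (by positivity : 0 ≤ 2 * p * (al / 8) ^ 2)
  nlinarith

lemma sum_pow_card (q : ℝ) : ∑ S : Finset (Fin n), q ^ S.card = (1 + q) ^ n := by
  have := Finset.sum_pow_mul_eq_add_pow q 1 (Finset.univ : Finset (Fin n))
  simpa [add_comm] using this

theorem measureReal_exists_discrepancy_le (hE : IsBernoulliEdges p E μ) (hp : 0 ≤ p) {al : ℝ}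
    (hal : 0 < al) (hal4 : al ≤ 4) (hn : 2 ≤ n)
    (hq : Real.exp (-(3 * al ^ 2 / 32 * (n * p))) ≤ 1 / (n : ℝ) ^ 7) :
    μ.real {ω | ∃ S T : Finset (Fin n), al * (n * p) * (S.card + T.card) <
      |∑ a ∈ S, ∑ b ∈ T, edgeDeviation p (E ω) a b|} ≤ 8 / (n : ℝ) ^ 6 := by
  classical
  set q := Real.exp (-(3 * al ^ 2 / 32 * (n * p))) with hqdef
  have hq0 : 0 < q := Real.exp_pos _
  have hn' : (2 : ℝ) ≤ n := by exact_mod_cast hn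
  have hsub : {ω | ∃ S T : Finset (Fin n), al * (n * p) * (S.card + T.card) <
      |∑ a ∈ S, ∑ b ∈ T, edgeDeviation p (E ω) a b|} ⊆
      ⋃ x ∈ (Finset.univ : Finset (Finset (Fin n) × Finset (Fin n))),
        {ω | al * (n * p) * (x.1.card + x.2.card) <
          |∑ a ∈ x.1, ∑ b ∈ x.2, edgeDeviation p (E ω) a b|} := by
    rintro ω ⟨S, T, h⟩
    exact Set.mem_biUnion (Finset.mem_coe.2 (Finset.mem_univ (S, T))) h
  -- The pair of empty sets never violates the strict inequality; removing its term 2 turns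
  -- 2(1+q)^(2n) into the small quantity 2((1+q)^(2n) − 1).
  have hterm : ∀ x : Finset (Fin n) × Finset (Fin n),
      μ.real {ω | al * (n * p) * (x.1.card + x.2.card) <
          |∑ a ∈ x.1, ∑ b ∈ x.2, edgeDeviation p (E ω) a b|} ≤
      2 * (q ^ x.1.card * q ^ x.2.card) - if x = (∅, ∅) then 2 else 0 := by
    intro x
    split_ifs with hx
    · subst hx; simp
    · rw [← pow_add, sub_zero]
      exact measureReal_discrepancy_le hE hp hal hal4 x.1 x.2
  refine (measureReal_mono hsub (measure_ne_top μ _)).trans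
    ((measureReal_biUnion_finset_le _ _).trans ((Finset.sum_le_sum fun x _ => hterm x).trans ?_))
  rw [Finset.sum_sub_distrib, ← Finset.mul_sum, Fintype.sum_prod_type]
  dsimp only
  rw [← Finset.sum_mul_sum, sum_pow_card]
  simp only [Finset.sum_ite_eq', Finset.mem_univ, if_true]
  have h1 : (1 + q) ^ n ≤ Real.exp (n * q) := by
    rw [Real.exp_nat_mul]
    gcongr
    linarith [Real.add_one_le_exp q]
  have h2 : 2 * (n * q) ≤ 2 / (n : ℝ) ^ 6 := by
    have : n * q ≤ n * (1 / (n : ℝ) ^ 7) := by gcongr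
    have e : n * (1 / (n : ℝ) ^ 7) = 1 / (n : ℝ) ^ 6 := by field_simp
    rw [e] at this
    have e' : 2 / (n : ℝ) ^ 6 = 2 * (1 / (n : ℝ) ^ 6) := by ring
    linarith
  have h3 : 2 / (n : ℝ) ^ 6 ≤ 1 := by
    rw [div_le_one (by positivity)]
    calc (2 : ℝ) ≤ 2 ^ 6 := by norm_num
      _ ≤ (n : ℝ) ^ 6 := by gcongr
  have h4 : (1 + q) ^ n * (1 + q) ^ n ≤ 1 + 2 * (2 * (n * q)) := by
    have hx0 : 0 ≤ 2 * (n * q) := by positivity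
    calc (1 + q) ^ n * (1 + q) ^ n ≤ Real.exp (n * q) * Real.exp (n * q) := by gcongr
      _ = Real.exp (2 * (n * q)) := by rw [← Real.exp_add]; ring_nf
      _ ≤ 1 + 2 * (n * q) + (2 * (n * q)) ^ 2 :=
          exp_le_of_abs_le_one (by rw [abs_of_nonneg hx0]; linarith)
      _ ≤ 1 + 2 * (2 * (n * q)) := by nlinarith
  have e' : 8 / (n : ℝ) ^ 6 = 4 * (2 / (n : ℝ) ^ 6) := by ring
  rw [e']
  linarith

lemma measureReal_row_le (hE : IsBernoulliEdges p E μ) (hp : 0 ≤ p) {ka : ℝ} (hka : 0 < ka)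
    (hka2 : ka ≤ 2) (l : Fin n) {c v : Fin n → ℝ} (hc : ∀ b, |c b| ≤ 1) :
    μ.real {ω | ka * (n * p) * ‖v‖ < |∑ b, edgeDeviation p (E ω) l b * (c b * v b)|} ≤
      2 * Real.exp (-(ka ^ 2 / 8 * (n * p))) := by
  rcases (norm_nonneg v).eq_or_lt with hv | hv
  · have hv0 : v = 0 := norm_eq_zero.1 hv.symm
    subst hv0
    simp; positivity
  -- This scale makes the weights at most ka/4; the exponent is then ka²/4 − ka²/8 times np.
  set th := ka / (4 * ‖v‖) with hth
  have hth0 : 0 < th := by positivity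
  have hthv : th * ‖v‖ = ka / 4 := by rw [hth]; field_simp
  have hb : ∀ b, |th * (c b * v b)| ≤ ka / 4 := by
    intro b
    rw [abs_mul, abs_mul, abs_of_pos hth0, ← hthv]
    have : |v b| ≤ ‖v‖ := by simpa using norm_le_pi_norm v b
    gcongr
    calc |c b| * |v b| ≤ 1 * ‖v‖ := by gcongr; exact hc b
      _ = ‖v‖ := one_mul _
  have h := measureReal_edgeDeviation_ge_le hE hp
    (w := fun a b => if a = l then th * (c b * v b) else 0)
    (fun a b => by
      split_ifs
      · linarith [hb b]
      · simp) (th * (ka * (n * p) * ‖v‖))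
  rw [sum_row_sq_eq] at h
  simp only [sum_row_eq] at h
  refine (measureReal_mono ?_ (measure_ne_top μ _)).trans (h.trans ?_)
  · intro ω hω
    simp only [Set.mem_ofPred_eq] at hω ⊢
    have : ∑ b, th * (c b * v b) * edgeDeviation p (E ω) l b =
        th * ∑ b, edgeDeviation p (E ω) l b * (c b * v b) := by
      rw [Finset.mul_sum]; exact Finset.sum_congr rfl fun b _ => by ring
    rw [this, abs_mul, abs_of_pos hth0]
    gcongr
  · gcongr
    have h1 : ∑ b, (th * (c b * v b)) ^ 2 ≤ n * (ka / 4) ^ 2 := by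
      calc ∑ b, (th * (c b * v b)) ^ 2 ≤ ∑ _b : Fin n, (ka / 4) ^ 2 :=
            Finset.sum_le_sum fun b _ =>
              sq_le_sq' (neg_le_of_abs_le (hb b)) (le_of_abs_le (hb b))
        _ = _ := by simp
    have h2 : th * (ka * (n * p) * ‖v‖) = ka / 4 * (ka * (n * p)) := by rw [← hthv]; ring
    rw [h2]
    nlinarith [mul_le_mul_of_nonneg_left h1 (by positivity : 0 ≤ 2 * p)]

/-- Row l depends only on the edges at l and V only on the others, so V can be frozen and the bound
for a fixed vector applies. -/
theorem measureReal_leaveOneOut_row_le (hE : IsBernoulliEdges p E μ) (hp : 0 ≤ p) {ka : ℝ}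
    (hka : 0 < ka) (hka2 : ka ≤ 2) (l : Fin n) {c : Fin n → ℝ} (hc : ∀ b, |c b| ≤ 1)
    (V : (Fin n → Fin n → ℝ) → Fin n → ℝ) :
    μ.real {ω | ka * (n * p) * ‖V (isolate (edgeWeight (E ω)) l)‖ <
      |∑ b, edgeDeviation p (E ω) l b * (c b * V (isolate (edgeWeight (E ω)) l) b)|} ≤
      2 * Real.exp (-(ka ^ 2 / 8 * (n * p))) := by
  classical
  let S : Finset (Pair n) := Finset.univ.filter fun e => e.1.1 = l ∨ e.1.2 = l
  let T : Finset (Pair n) := Finset.univ.filter fun e => ¬(e.1.1 = l ∨ e.1.2 = l)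
  let ext : ∀ U : Finset (Pair n), (U → Prop) → Pair n → Prop :=
    fun U x e => ∃ h : e ∈ U, x ⟨e, h⟩
  have hS : ∀ ω b, edgeDeviation p (E ω) l b =
      edgeDeviation p (ext S fun e => E ω e) l b := by
    intro ω b
    unfold edgeDeviation
    congr 1
    refine edgeWeight_congr fun e he => ?_
    have : e ∈ S := by
      rcases he with he | he <;> simp [S, he]
    simp [ext, this]
  have hT : ∀ ω, isolate (edgeWeight (E ω)) l =
      isolate (edgeWeight (ext T fun e => E ω e)) l := by
    intro ω
    funext a b
    by_cases h : a = l ∨ b = l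
    · simp [isolate, h]
    · simp only [isolate, h, if_false]
      refine edgeWeight_congr fun e he => ?_
      have : e ∈ T := by
        rcases he with he | he <;> simp [T, he] <;> tauto
      simp [ext, this]
  have hind := hE.indep.indepFun_finset₀ S T
    (Finset.disjoint_filter_filter_not _ _ _) hE.aemeasurable
  have h := measureReal_le_of_indepFun
    (aemeasurable_pi_lambda _ fun e : S => hE.aemeasurable e)
    (aemeasurable_pi_lambda _ fun e : T => hE.aemeasurable e) hind
    (B := fun x y => ka * (n * p) * ‖V (isolate (edgeWeight (ext T y)) l)‖ <
      |∑ b, edgeDeviation p (ext S x) l b * (c b * V (isolate (edgeWeight (ext T y)) l) b)|)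
    (q := 2 * Real.exp (-(ka ^ 2 / 8 * (n * p)))) (fun y => by
      simp only [← hS]
      exact measureReal_row_le hE hp hka hka2 l hc)
  simpa only [← hS, ← hT] using h

end GraphConcentration

/-! ### Concentration of the comparison outcomes -/

section NoiseConcentration

variable {n k : ℕ} {Ω : Type*} [MeasurableSpace Ω] {μ : Measure Ω} [IsProbabilityMeasure μ]
  {Z : Pair n → Fin k → Ω → Bool} {α : Fin n → ℝ}

lemma prefProb_nonneg (hα : ∀ i, 0 < α i) (i j : Fin n) : 0 ≤ prefProb α i j := by
  have := hα i; have := hα j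
  unfold prefProb; positivity

lemma prefProb_add (hα : ∀ i, 0 < α i) (i j : Fin n) : prefProb α i j + prefProb α j i = 1 := by
  have := hα i; have := hα j
  unfold prefProb
  rw [add_comm (α j) (α i), ← add_div, add_comm (α j), div_self (by positivity)]

lemma prefProb_le_one (hα : ∀ i, 0 < α i) (i j : Fin n) : prefProb α i j ≤ 1 := by
  linarith [prefProb_add hα i j, prefProb_nonneg hα j i]

lemma wins_add (z : Pair n → Fin k → Bool) {i j : Fin n} (hij : i ≠ j) :
    wins z i j + wins z j i = k := by
  have key : ∀ e : Pair n, (Finset.univ.filter fun m => z e m = true).card +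
      (Finset.univ.filter fun m => z e m = false).card = k := by
    intro e
    have := Finset.card_filter_add_card_filter_not (s := (Finset.univ : Finset (Fin k)))
      (fun m => z e m = true)
    simpa using this
  unfold wins
  rcases lt_or_gt_of_ne hij with h | h
  · simpa [h, h.not_gt] using key ⟨(i, j), h⟩
  · simpa [h, h.not_gt, add_comm] using key ⟨(j, i), h⟩

lemma empProb_add (hk : 1 ≤ k) (z : Pair n → Fin k → Bool) {i j : Fin n} (hij : i ≠ j) :
    empProb z i j + empProb z j i = 1 := by
  have hk' : (0 : ℝ) < k := by exact_mod_cast hk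
  have : (wins z i j : ℝ) + wins z j i = k := by exact_mod_cast wins_add z hij
  rw [empProb, empProb, ← add_div, this, div_self hk'.ne']

lemma empProb_nonneg (z : Pair n → Fin k → Bool) (i j : Fin n) : 0 ≤ empProb z i j := by
  unfold empProb; positivity

lemma empProb_le_one (hk : 1 ≤ k) (z : Pair n → Fin k → Bool) (i j : Fin n) :
    empProb z i j ≤ 1 := by
  by_cases h : i = j
  · subst h; simp [empProb, wins]
  · linarith [empProb_add hk z h, empProb_nonneg z j i]

/-- The error of the empirical probabilities. -/
def noise (α : Fin n → ℝ) (z : Pair n → Fin k → Bool) (a b : Fin n) : ℝ :=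
  if a = b then 0 else empProb z a b - prefProb α a b

lemma noise_comm (hα : ∀ i, 0 < α i) (hk : 1 ≤ k) (z : Pair n → Fin k → Bool) (a b : Fin n) :
    noise α z b a = -noise α z a b := by
  by_cases h : a = b
  · subst h; simp [noise]
  · rw [noise, noise, if_neg h, if_neg (Ne.symm h)]
    linarith [empProb_add hk z h, prefProb_add hα a b]

lemma abs_noise_le_one (hα : ∀ i, 0 < α i) (hk : 1 ≤ k) (z : Pair n → Fin k → Bool)
    (a b : Fin n) : |noise α z a b| ≤ 1 := by
  unfold noise
  split_ifs
  · simp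
  · rw [abs_le]
    constructor <;> linarith [empProb_nonneg z a b, empProb_le_one hk z a b,
      prefProb_nonneg hα a b, prefProb_le_one hα a b]

/-- Noise is antisymmetric, so each of the k outcomes of a pair has coefficient (w a b − w b a)/k.
-/
theorem measureReal_noise_ge_le (hα : ∀ i, 0 < α i) (hk : 1 ≤ k)
    (hm : ∀ e m, Measurable (Z e m))
    (hlaw : ∀ e m, μ.real {ω | Z e m ω = true} = prefProb α e.1.1 e.1.2)
    (hind : iIndepFun (fun x : Pair n × Fin k => Z x.1 x.2) μ)
    {w : Fin n → Fin n → ℝ} (hw : ∀ a b, |w a b| ≤ k / 2) (t : ℝ) :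
    μ.real {ω | t ≤ |∑ a, ∑ b, w a b * noise α (fun e m => Z e m ω) a b|} ≤
      2 * Real.exp (2 / k * ∑ a, ∑ b, w a b ^ 2 - t) := by
  have hk' : (0 : ℝ) < k := by exact_mod_cast hk
  let X : Pair n × Fin k → Ω → ℝ := fun x ω => if Z x.1 x.2 ω = true then 1 else 0
  have hmeas : Measurable fun q : Bool => if q = true then (1 : ℝ) else 0 := measurable_from_top
  have hX : iIndepFun X μ :=
    hind.comp (fun _ q => if q = true then (1 : ℝ) else 0) fun _ => hmeas
  have hXm : ∀ x, AEMeasurable (X x) μ := fun x => (hmeas.comp (hm x.1 x.2)).aemeasurable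
  have hq : ∀ x, μ[X x] = prefProb α x.1.1.1 x.1.1.2 := fun x => by
    classical
    rw [← hlaw x.1 x.2]
    refine Eq.trans ?_ (integral_ite_eq (s := fun ω => Z x.1 x.2 ω = true) ?_)
    · exact integral_congr_ae (Filter.Eventually.of_forall fun ω => by simp [X])
    · exact ((measurable_from_top (f := fun q : Bool => q = true)).comp
        (hm x.1 x.2)).aemeasurable
  have h := measureReal_abs_sum_centered_ge_le hX hXm
    (fun e ω => by simp only [X]; split_ifs <;> simp)
    (fun e ω => by simp only [X]; split_ifs <;> simp)
    (c := fun x => (w x.1.1.1 x.1.1.2 - w x.1.1.2 x.1.1.1) / k) (fun x => by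
      rw [abs_div, abs_of_pos hk', div_le_one hk']
      have := abs_sub (w x.1.1.1 x.1.1.2) (w x.1.1.2 x.1.1.1)
      linarith [hw x.1.1.1 x.1.1.2, hw x.1.1.2 x.1.1.1]) t
  simp only [hq] at h
  have e1 : ∀ ω, ∑ a, ∑ b, w a b * noise α (fun e m => Z e m ω) a b =
      ∑ x : Pair n × Fin k, (w x.1.1.1 x.1.1.2 - w x.1.1.2 x.1.1.1) / k *
        (X x ω - prefProb α x.1.1.1 x.1.1.2) := by
    intro ω
    rw [sum_sum_eq_sum_pair (by simp [noise]), Fintype.sum_prod_type]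
    refine Finset.sum_congr rfl fun e _ => ?_
    dsimp only
    rw [← Finset.mul_sum, Finset.sum_sub_distrib, noise_comm hα hk _ e.1.1 e.1.2, noise,
      if_neg e.2.ne, empProb, wins, dif_pos e.2]
    have : ∑ m, X (e, m) ω =
        ((Finset.univ.filter fun m => Z e m ω = true).card : ℝ) := by
      simp [X]
    rw [this]
    simp
    field_simp
    ring
  simp only [e1]
  refine h.trans ?_
  gcongr
  calc ∑ x : Pair n × Fin k, ((w x.1.1.1 x.1.1.2 - w x.1.1.2 x.1.1.1) / k) ^ 2 *
        prefProb α x.1.1.1 x.1.1.2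
      ≤ ∑ x : Pair n × Fin k,
        2 / (k : ℝ) ^ 2 * (w x.1.1.1 x.1.1.2 ^ 2 + w x.1.1.2 x.1.1.1 ^ 2) := by
        refine Finset.sum_le_sum fun x _ => ?_
        refine (mul_le_of_le_one_right (sq_nonneg _) (prefProb_le_one hα _ _)).trans ?_
        rw [div_pow, div_mul_eq_mul_div]
        gcongr
        nlinarith [sq_nonneg (w x.1.1.1 x.1.1.2 + w x.1.1.2 x.1.1.1)]
    _ = 2 / k * ∑ e : Pair n, (w e.1.1 e.1.2 ^ 2 + w e.1.2 e.1.1 ^ 2) := by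
        rw [Fintype.sum_prod_type, Finset.mul_sum]
        refine Finset.sum_congr rfl fun e _ => ?_
        simp
        field_simp
    _ ≤ 2 / k * ∑ a, ∑ b, w a b ^ 2 := by
        gcongr; exact sum_pair_sq_le w

theorem measureReal_noise_row_ge_le (hα : ∀ i, 0 < α i) (hk : 1 ≤ k)
    (hm : ∀ e m, Measurable (Z e m))
    (hlaw : ∀ e m, μ.real {ω | Z e m ω = true} = prefProb α e.1.1 e.1.2)
    (hind : iIndepFun (fun x : Pair n × Fin k => Z x.1 x.2) μ)
    {u : Fin n → ℝ} (hu : ∀ b, |u b| ≤ 1) {d L : ℝ} (hL : 0 < L) (hLd : 4 * L ≤ d)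
    (hud : ∑ b, u b ^ 2 ≤ 2 * d) (l : Fin n) :
    μ.real {ω | 11 * √(d * L / k) ≤ |∑ b, u b * noise α (fun e m => Z e m ω) l b|} ≤
      2 * Real.exp (-(7 * L)) := by
  have hk' : (1 : ℝ) ≤ k := by exact_mod_cast hk
  have hd : 0 < d := by linarith
  -- At this scale the threshold becomes 11L and the variance term at most 4L, leaving 7L.
  set th := √(k * L / d) with hth
  have hth0 : 0 < th := Real.sqrt_pos.2 (by positivity)
  have hth2 : th ^ 2 = k * L / d := Real.sq_sqrt (by positivity)
  have hthk : th ≤ k / 2 := by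
    rw [hth, Real.sqrt_le_left (by positivity), div_le_iff₀ hd]
    nlinarith [mul_le_mul_of_nonneg_left hLd (by positivity : (0 : ℝ) ≤ k ^ 2),
      mul_nonneg (by linarith : (0 : ℝ) ≤ k - 1) (by positivity : (0 : ℝ) ≤ k * L)]
  have h := measureReal_noise_ge_le hα hk hm hlaw hind
    (w := fun a b => if a = l then th * u b else 0) (fun a b => by
      split_ifs
      · rw [abs_mul, abs_of_pos hth0]
        nlinarith [hu b, abs_nonneg (u b)]
      · simp; positivity) (th * (11 * √(d * L / k)))
  rw [sum_row_sq_eq] at h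
  simp only [sum_row_eq] at h
  refine (measureReal_mono ?_ (measure_ne_top μ _)).trans (h.trans ?_)
  · intro ω hω
    simp only [Set.mem_ofPred_eq] at hω ⊢
    have : ∑ b, th * u b * noise α (fun e m => Z e m ω) l b =
        th * ∑ b, u b * noise α (fun e m => Z e m ω) l b := by
      rw [Finset.mul_sum]; exact Finset.sum_congr rfl fun b _ => by ring
    rw [this, abs_mul, abs_of_pos hth0]
    gcongr
  · gcongr
    have h1 : th * √(d * L / k) = L := by
      rw [hth, ← Real.sqrt_mul (by positivity)]
      have : k * L / d * (d * L / k) = L ^ 2 := by field_simp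
      rw [this, Real.sqrt_sq hL.le]
    have h2 : 2 / k * ∑ b, (th * u b) ^ 2 ≤ 4 * L := by
      simp only [mul_pow]
      rw [← Finset.mul_sum, hth2]
      calc 2 / k * (k * L / d * ∑ b, u b ^ 2) ≤ 2 / k * (k * L / d * (2 * d)) := by gcongr
        _ = 4 * L := by field_simp; ring
    nlinarith

theorem measureReal_noise_entry_ge_le (hα : ∀ i, 0 < α i) (hk : 1 ≤ k)
    (hm : ∀ e m, Measurable (Z e m))
    (hlaw : ∀ e m, μ.real {ω | Z e m ω = true} = prefProb α e.1.1 e.1.2)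
    (hind : iIndepFun (fun x : Pair n × Fin k => Z x.1 x.2) μ)
    {L : ℝ} (hL : 0 < L) (a b : Fin n) :
    μ.real {ω | 11 * √(L / k) ≤ |noise α (fun e m => Z e m ω) a b|} ≤
      2 * Real.exp (-(7 * L)) := by
  have hk' : (1 : ℝ) ≤ k := by exact_mod_cast hk
  -- For k < 4L the threshold exceeds 1, which noise never does; otherwise the scale √(kL) is at
  -- most k/2.
  rcases lt_or_ge (k : ℝ) (4 * L) with hkL | hkL
  · have h1 : (1 / 2 : ℝ) ≤ √(L / k) := by
      apply Real.le_sqrt_of_sq_le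
      rw [le_div_iff₀ (by linarith)]; linarith
    have h2 : {ω | 11 * √(L / k) ≤ |noise α (fun e m => Z e m ω) a b|} = ∅ := by
      ext ω
      simp only [Set.mem_ofPred_eq, Set.mem_empty_iff_false, iff_false, not_le]
      linarith [abs_noise_le_one hα hk (fun e m => Z e m ω) a b]
    rw [h2]; simp; positivity
  set th := √(k * L) with hth
  have hth0 : 0 < th := Real.sqrt_pos.2 (by positivity)
  have hth2 : th ^ 2 = k * L := Real.sq_sqrt (by positivity)
  have hthk : th ≤ k / 2 := by
    rw [hth, Real.sqrt_le_left (by positivity)]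
    nlinarith
  have hs : ∀ f : Fin n → ℝ, ∑ b', (if b' = b then th else 0) * f b' = th * f b := by
    intro f; simp
  have h := measureReal_noise_ge_le hα hk hm hlaw hind
    (w := fun a' b' => if a' = a then (if b' = b then th else 0) else 0) (fun a' b' => by
      split_ifs
      · rwa [abs_of_pos hth0]
      all_goals (simp; positivity)) (th * (11 * √(L / k)))
  rw [sum_row_sq_eq] at h
  simp only [sum_row_eq, hs] at h
  refine (measureReal_mono ?_ (measure_ne_top μ _)).trans (h.trans ?_)
  · intro ω hω
    simp only [Set.mem_ofPred_eq] at hω ⊢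
    rw [abs_mul, abs_of_pos hth0]
    gcongr
  · gcongr
    have h1 : th * √(L / k) = L := by
      rw [hth, ← Real.sqrt_mul (by positivity)]
      have : k * L * (L / k) = L ^ 2 := by field_simp
      rw [this, Real.sqrt_sq hL.le]
    have h2 : 2 / k * ∑ b', (if b' = b then th else 0) ^ 2 = 2 * L := by
      simp only [ite_pow, zero_pow two_ne_zero, Finset.sum_ite_eq', Finset.mem_univ, if_true,
        hth2]
      field_simp
    rw [h2]
    nlinarith

end NoiseConcentration

/-! ### Balanced vectors and stationary distributions -/

section Stationary

/-- By the triangle inequality |ρ| has nonpositive flow everywhere; as flows sum to zero, |ρ| is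
balanced. Uniqueness makes |ρ| a multiple of ρ, with factor ∑|ρ| ≥ 1, so ρ ≥ 0. -/
lemma nonneg_of_unique_balanced {ι : Type*} [Fintype ι] {A P : ι → ι → ℝ} {ρ : ι → ℝ}
    (hA : ∀ i j, A i j = A j i) (hA0 : ∀ i j, 0 ≤ A i j) (hP0 : ∀ i j, 0 ≤ P i j)
    (hker : ∀ x ∈ sumZero (∅ : Set ι), flow A P x = 0 → x = 0)
    (hsum : ∑ i, ρ i = 1) (hρ : flow A P ρ = 0) (i : ι) : 0 ≤ ρ i := by
  set w : ι → ℝ := fun i => |ρ i| with hw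
  have hle : ∀ i, flow A P w i ≤ 0 := by
    intro i
    have h0 := congrFun hρ i
    simp only [flow_apply, mul_sub, Finset.sum_sub_distrib, Pi.zero_apply] at h0 ⊢
    have h1 : ∑ j, A i j * (P i j * w i) = |∑ j, A i j * (P i j * ρ i)| := by
      have e : ∀ y, ∑ j, A i j * (P i j * y) = (∑ j, A i j * P i j) * y := fun y => by
        rw [Finset.sum_mul]; exact Finset.sum_congr rfl fun j _ => by ring
      rw [e, e, abs_mul, abs_of_nonneg (Finset.sum_nonneg fun j _ => mul_nonneg (hA0 i j) (hP0 i j))]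
    have h2 : |∑ j, A i j * (P j i * ρ j)| ≤ ∑ j, A i j * (P j i * w j) := by
      refine (Finset.abs_sum_le_sum_abs _ _).trans (le_of_eq (Finset.sum_congr rfl fun j _ => ?_))
      rw [abs_mul, abs_mul, abs_of_nonneg (hA0 i j), abs_of_nonneg (hP0 j i)]
    rw [h1, sub_eq_zero.1 h0]
    linarith
  have hw0 : flow A P w = 0 := by
    funext i
    exact (Finset.sum_eq_zero_iff_of_nonpos fun i _ => hle i).1 (sum_flow hA w) i
      (Finset.mem_univ i)
  have hx : w - (∑ i, w i) • ρ ∈ sumZero (∅ : Set ι) := by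
    refine ⟨?_, by simp⟩
    simp [← Finset.mul_sum, hsum]
  have hx0 := hker _ hx (by rw [map_sub, map_smul, hw0, hρ]; simp)
  have hi := congrFun hx0 i
  simp only [Pi.sub_apply, Pi.smul_apply, smul_eq_mul, Pi.zero_apply] at hi
  have hpos : 1 ≤ ∑ i, w i := by
    rw [← hsum]; exact Finset.sum_le_sum fun i _ => le_abs_self _
  by_contra! hneg
  have : 0 ≤ w i := abs_nonneg _
  nlinarith

variable {n : ℕ}

/-- Only the nonvanishing of the normalization D matters later. Without edges D may be 0, and 1/0 =
0 agrees with the identity matrix. -/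
lemma vecMul_markovMatrix (g : SimpleGraph (Fin n)) (P : Fin n → Fin n → ℝ) (ρ : Fin n → ℝ) :
    ∃ D : ℕ, ((∃ a b, g.Adj a b) → D ≠ 0) ∧ ∀ j,
      Matrix.vecMul ρ (markovMatrix g P) j =
        ρ j - 1 / (D : ℝ) * flow (edgeWeight (edges g)) P ρ j := by
  classical
  refine ⟨g.maxDegree, ?_, fun j => ?_⟩
  · rintro ⟨a, b, hab⟩ h
    have h1 : 0 < g.degree a := (g.degree_pos_iff_exists_adj a).2 ⟨b, hab⟩
    have h2 := g.degree_le_maxDegree a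
    omega
  · have hS : ∀ i, markovMatrix g P i j =
        1 / (g.maxDegree : ℝ) * ((if g.Adj i j then 1 else 0) * P i j) +
        if i = j then 1 - 1 / (g.maxDegree : ℝ) * ∑ l, (if g.Adj j l then 1 else 0) * P j l
          else 0 := by
      intro i
      unfold markovMatrix
      by_cases hij : i = j
      · subst hij
        simp [Finset.sum_filter]
      · by_cases hadj : g.Adj i j
        · simp [hij, hadj]; ring
        · simp [hij, hadj]
    simp only [Matrix.vecMul, dotProduct, hS, flow_apply, edgeWeight_edges, mul_add,
      Finset.sum_add_distrib]
    simp only [mul_ite, mul_zero, Finset.sum_ite_eq', Finset.mem_univ, if_true]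
    rw [Finset.mul_sum, Finset.mul_sum, mul_sub, mul_one, Finset.mul_sum]
    rw [add_comm, sub_add, ← Finset.sum_sub_distrib]
    congr 1
    refine Finset.sum_congr rfl fun l _ => ?_
    by_cases hadj : g.Adj j l
    · simp [hadj, hadj.symm]; ring
    · have : ¬ g.Adj l j := fun h => hadj h.symm
      simp [hadj, this]

lemma isStationaryDistribution_iff {g : SimpleGraph (Fin n)} (hg : ∃ a b, g.Adj a b)
    (P : Fin n → Fin n → ℝ) (ρ : Fin n → ℝ) :
    IsStationaryDistribution (markovMatrix g P) ρ ↔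
      ((∀ i, 0 ≤ ρ i) ∧ ∑ i, ρ i = 1) ∧ flow (edgeWeight (edges g)) P ρ = 0 := by
  obtain ⟨D, hD, h⟩ := vecMul_markovMatrix g P ρ
  have hD' : (D : ℝ) ≠ 0 := by exact_mod_cast hD hg
  rw [IsStationaryDistribution, stdSimplex]
  refine and_congr (by simp) ?_
  constructor
  · intro hst
    funext j
    have := congrFun hst j
    rw [h] at this
    have h2 : 1 / (D : ℝ) * flow (edgeWeight (edges g)) P ρ j = 0 := by linarith
    rcases mul_eq_zero.1 h2 with h3 | h3
    · exact absurd h3 (one_div_ne_zero hD')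
    · exact h3
  · intro hf
    funext j
    rw [h, hf]; simp

end Stationary

/-! ### The good event and its deterministic consequences -/

section GoodEvent

variable {n k : ℕ}

lemma canonicalScore_pos {α : Fin n → ℝ} (hα : ∀ i, 0 < α i) (i : Fin n) :
    0 < canonicalScore α i :=
  div_pos (hα i) (Finset.sum_pos (fun j _ => hα j) ⟨i, Finset.mem_univ i⟩)

lemma sum_canonicalScore {α : Fin n → ℝ} (hα : ∀ i, 0 < α i) (hn : 1 ≤ n) :
    ∑ i, canonicalScore α i = 1 := by
  unfold canonicalScore
  rw [← Finset.sum_div, div_self]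
  exact (Finset.sum_pos (fun j _ => hα j) ⟨⟨0, hn⟩, Finset.mem_univ _⟩).ne'

/-- Detailed balance of the Bradley-Terry-Luce chain, up to the noise. -/
lemma empProb_mul_canonicalScore_sub {α : Fin n → ℝ} (hα : ∀ i, 0 < α i) (hk : 1 ≤ k)
    (z : Pair n → Fin k → Bool) {i j : Fin n} (hij : i ≠ j) :
    empProb z i j * canonicalScore α i - empProb z j i * canonicalScore α j =
      noise α z i j * (canonicalScore α i + canonicalScore α j) := by
  have h1 : prefProb α i j * canonicalScore α i = prefProb α j i * canonicalScore α j := by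
    have := hα i; have := hα j
    unfold prefProb canonicalScore
    rw [add_comm (α j) (α i)]
    ring
  have h2 := noise_comm hα hk z i j
  rw [noise, noise, if_neg hij, if_neg hij.symm] at h2
  rw [noise, if_neg hij]
  linear_combination h1 - canonicalScore α j * h2

/-- The pair weights `(π_l + π_b) / (2 ‖π‖)`. -/
def relScore (α : Fin n → ℝ) (l b : Fin n) : ℝ :=
  (canonicalScore α l + canonicalScore α b) / (2 * ‖canonicalScore α‖)

lemma canonicalScore_le_norm (α : Fin n → ℝ) (i : Fin n) :
    canonicalScore α i ≤ ‖canonicalScore α‖ :=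
  (le_abs_self _).trans (by simpa using norm_le_pi_norm (canonicalScore α) i)

lemma abs_relScore_le_one {α : Fin n → ℝ} (hα : ∀ i, 0 < α i) (l b : Fin n) :
    |relScore α l b| ≤ 1 := by
  have h1 := canonicalScore_pos hα l
  have h2 := canonicalScore_pos hα b
  have h3 := canonicalScore_le_norm α l
  have h4 := canonicalScore_le_norm α b
  have h5 : 0 < ‖canonicalScore α‖ := by linarith
  unfold relScore
  rw [abs_of_nonneg (by positivity), div_le_one (by positivity)]
  linarith

/-- The event on which the estimate is accurate. -/
structure IsGood (α : Fin n → ℝ) (p al ka : ℝ) (s : Pair n → Prop) (z : Pair n → Fin k → Bool) :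
    Prop where
  discrepancy : ∀ S T : Finset (Fin n),
    |∑ a ∈ S, ∑ b ∈ T, edgeDeviation p s a b| ≤ al * (n * p) * (S.card + T.card)
  degree : ∀ l, |∑ b, edgeDeviation p s l b| ≤ ka * (n * p)
  leaveOneOut : ∀ l, |∑ b, edgeDeviation p s l b * (empProb z b l *
      leaveOneOut (isolate (edgeWeight s) l) (empProb z) (canonicalScore α) l b)| ≤
    ka * (n * p) * ‖leaveOneOut (isolate (edgeWeight s) l) (empProb z) (canonicalScore α) l‖
  row : ∀ l, |∑ b, edgeWeight s l b * noise α z l b| ≤ 11 * √(n * p * Real.log n / k)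
  weightedRow : ∀ l, |∑ b, edgeWeight s l b * relScore α l b * noise α z l b| ≤
    11 * √(n * p * Real.log n / k)
  entry : ∀ a b, |noise α z a b| ≤ 11 * √(Real.log n / k)

lemma degree_bounds {s : Pair n → Prop} {p ka : ℝ} (hp : 0 ≤ p) {l : Fin n}
    (h : |∑ b, edgeDeviation p s l b| ≤ ka * (n * p)) :
    (1 - ka) * (n * p) - p ≤ ∑ b, edgeWeight s l b ∧
      ∑ b, edgeWeight s l b ≤ (1 + ka) * (n * p) := by
  have h1 : ∑ b, edgeDeviation p s l b = ∑ b, edgeWeight s l b - (n * p - p) := by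
    simp only [edgeDeviation, Finset.sum_sub_distrib]
    congr 1
    have : ∀ b, (if l = b then 0 else p) = p - if l = b then p else 0 := fun b => by
      split_ifs <;> simp
    simp only [this, Finset.sum_sub_distrib]
    simp
  rw [h1, abs_le] at h
  constructor <;> linarith [h.1, h.2]

/-- The mean is p off the diagonal: on sum-zero vectors the constant matrix vanishes and the missing
diagonal contributes −p ∑ x², of the favourable sign. The absolute row sums of the deviation are at
most R + np. -/
lemma sum_edgeWeight_quadratic_le {s : Pair n → Prop} {p al R : ℝ} (hp : 0 ≤ p) (hal : 0 ≤ al)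
    (hdisc : ∀ S T : Finset (Fin n),
      |∑ a ∈ S, ∑ b ∈ T, edgeDeviation p s a b| ≤ al * (n * p) * (S.card + T.card))
    (hdeg : ∀ l, ∑ b, edgeWeight s l b ≤ R) (hR : 0 ≤ R) (K : ℕ) {x : Fin n → ℝ}
    (hx : ∑ i, x i = 0) :
    ∑ i, ∑ j, edgeWeight s i j * x i * x j ≤
      4 * discrepancyBound K (al * (n * p)) (R + n * p) * ∑ i, x i ^ 2 := by
  have hnn : ∀ a b, 0 ≤ edgeWeight s a b := fun a b => by
    rcases edgeWeight_zero_or_one s a b with h | h <;> simp [h]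
  have hrow : ∀ a (T : Finset (Fin n)), ∑ b ∈ T, |edgeDeviation p s a b| ≤ R + n * p := by
    intro a T
    calc ∑ b ∈ T, |edgeDeviation p s a b| ≤ ∑ b, |edgeDeviation p s a b| :=
          Finset.sum_le_sum_of_subset_of_nonneg (Finset.subset_univ _) fun _ _ _ => abs_nonneg _
      _ ≤ ∑ b, (edgeWeight s a b + p) := by
          refine Finset.sum_le_sum fun b _ => ?_
          unfold edgeDeviation
          have := hnn a b
          split_ifs <;> rw [abs_le] <;> constructor <;> linarith
      _ ≤ R + n * p := by
          rw [Finset.sum_add_distrib]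
          simpa using hdeg a
  have hcomm : ∀ a b, edgeDeviation p s a b = edgeDeviation p s b a := fun a b => by
    simp only [edgeDeviation, edgeWeight_comm s a b, eq_comm]
  have h2 : ∀ S T : Finset (Fin n),
      |∑ a ∈ S, ∑ b ∈ T, edgeDeviation p s a b| ≤ (R + n * p) * S.card := by
    intro S T
    calc |∑ a ∈ S, ∑ b ∈ T, edgeDeviation p s a b| ≤ ∑ a ∈ S, (R + n * p) :=
          (Finset.abs_sum_le_sum_abs _ _).trans (Finset.sum_le_sum fun a _ =>
            (Finset.abs_sum_le_sum_abs _ _).trans (hrow a T))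
      _ = _ := by rw [Finset.sum_const, nsmul_eq_mul, mul_comm]
  have h3 : ∀ S T : Finset (Fin n),
      |∑ a ∈ S, ∑ b ∈ T, edgeDeviation p s a b| ≤ (R + n * p) * T.card := by
    intro S T
    rw [Finset.sum_comm]
    refine (le_of_eq ?_).trans (h2 T S)
    congr 1
    exact Finset.sum_congr rfl fun b _ => Finset.sum_congr rfl fun a _ => hcomm a b
  have h := abs_quadratic_le (by positivity) (by positivity) hdisc h2 h3 K x
  refine le_trans ?_ ((le_abs_self _).trans h)
  have e : ∑ a, ∑ b, edgeDeviation p s a b * x a * x b =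
      ∑ a, ∑ b, edgeWeight s a b * x a * x b - p * ((∑ a, x a) * ∑ b, x b) +
        p * ∑ a, x a ^ 2 := by
    have ht : ∀ a b, edgeDeviation p s a b * x a * x b =
        edgeWeight s a b * x a * x b - p * (x a * x b) + if a = b then p * x a ^ 2 else 0 := by
      intro a b
      unfold edgeDeviation
      split_ifs with hab
      · subst hab; ring
      · ring
    simp only [ht, Finset.sum_add_distrib, Finset.sum_sub_distrib]
    congr 1
    · congr 1
      rw [Finset.sum_mul_sum]
      simp only [Finset.mul_sum]
    · simp [Finset.mul_sum]
  rw [e, hx]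
  have : 0 ≤ p * ∑ a, x a ^ 2 := mul_nonneg hp (Finset.sum_nonneg fun a _ => sq_nonneg _)
  linarith

end GoodEvent

/-! ### The estimate on the good event -/

section Estimate

variable {n k : ℕ}

/-- The choice of λ gives p_ij ≥ 1/(1 + H) = 4λ. In `hK`, the 3 is the row-sum bound 2d + np in
units of d = np; 128 yields κ²d ≥ 2, and 484 = 22² makes the row noise at most λd/2. -/
theorem stationary_of_isGood {α : Fin n → ℝ} {p al lam H : ℝ} {g : SimpleGraph (Fin n)}
    {z : Pair n → Fin k → Bool} {K : ℕ} (hα : ∀ i, 0 < α i) (hH : 0 < H)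
    (hratio : ∀ i j, α i / α j ≤ H) (hn : 1 ≤ n) (hk : 1 ≤ k) (hp : 0 ≤ p) (hp1 : p ≤ 1)
    (hlam : lam = 1 / (4 * (1 + H))) (hal : 0 ≤ al)
    (hK : 4 * (2 * ((K + 1) * (al * 2 ^ K) + 3 * (1 / 2) ^ K)) ≤ 2 * lam)
    (hd : 128 / lam ^ 2 ≤ n * p)
    (hdL : 484 / lam ^ 2 * Real.log n ≤ n * p)
    (hgood : IsGood α p al (lam / 8) (edges g) z) :
    (∃! ρ, IsStationaryDistribution (markovMatrix g (empProb z)) ρ) ∧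
    ∀ ρ, IsStationaryDistribution (markovMatrix g (empProb z)) ρ →
      ‖ρ - canonicalScore α‖ / ‖canonicalScore α‖ ≤
        44 * ((3 + 2 / lam) / lam) * √(Real.log n / (n * p * k)) := by
  have : Nonempty (Fin n) := ⟨⟨0, hn⟩⟩
  have hlam0 : 0 < lam := by rw [hlam]; positivity
  have hlam1 : lam ≤ 1 / 4 := by
    rw [hlam]
    exact one_div_le_one_div_of_le (by norm_num) (by linarith)
  have hk' : (1 : ℝ) ≤ k := by exact_mod_cast hk
  set L := Real.log n with hLdef
  set d : ℝ := n * p with hddef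
  have hlamd2 : 128 ≤ lam ^ 2 * d := by
    have := (div_le_iff₀ (by positivity)).1 hd; linarith
  have hd0 : 0 < d := by
    by_contra! h
    nlinarith [sq_nonneg lam]
  have hlamd : 512 ≤ lam * d := by nlinarith
  have hd8 : 512 ≤ d := by nlinarith
  set ρ := canonicalScore α with hρdef
  set A := edgeWeight (edges g) with hAdef
  set P : Fin n → Fin n → ℝ := empProb z with hPdef
  set τ := ‖ρ‖ with hτdef
  have hτ : 0 < τ := (canonicalScore_pos hα (Classical.arbitrary _)).trans_le
    (canonicalScore_le_norm α _)
  have hAnn : ∀ a b, 0 ≤ A a b := fun a b => by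
    rcases edgeWeight_zero_or_one (edges g) a b with h | h <;> simp [A, h]
  have hdeg := fun l => degree_bounds hp (hgood.degree l)
  have hdeg2 : ∀ l, ∑ b, A l b ≤ 2 * d := fun l => (hdeg l).2.trans (by nlinarith)
  have hrow : 11 * √(d * L / k) ≤ lam / 2 * d := by
    have h1 : √(d * L / k) ≤ lam / 22 * d := by
      rw [Real.sqrt_le_left (by positivity), div_le_iff₀ (by linarith)]
      have h2 : 484 * L ≤ lam ^ 2 * d := by
        rw [div_mul_eq_mul_div, div_le_iff₀ (by positivity)] at hdL; linarith
      have h3 : d * L ≤ (lam / 22 * d) ^ 2 := by nlinarith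
      nlinarith [sq_nonneg (lam / 22 * d)]
    linarith
  have hpref : ∀ i j, 4 * lam ≤ prefProb α i j := by
    intro i j
    have h1 := hα i
    have h2 := hα j
    have h3 : α i ≤ H * α j := (div_le_iff₀ h2).1 (hratio i j)
    have e : 4 * lam = 1 / (1 + H) := by rw [hlam]; field_simp
    rw [e, prefProb, div_le_div_iff₀ (by positivity) (by positivity)]
    linarith
  -- Degrees are at least 3d/4, so the row sum is at least 3λd − λd/2, with room for the 1 because
  -- λd ≥ 512.
  have hD : ∀ i, 2 * (lam * d) + 1 ≤ ∑ j, A i j * P i j := by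
    intro i
    have h1 : ∑ j, A i j * P i j =
        ∑ j, A i j * prefProb α i j + ∑ j, A i j * noise α z i j := by
      rw [← Finset.sum_add_distrib]
      refine Finset.sum_congr rfl fun j _ => ?_
      by_cases hij : i = j
      · subst hij; simp [A, edgeWeight_self]
      · rw [noise, if_neg hij]; ring
    have h2 : 4 * lam * ∑ j, A i j ≤ ∑ j, A i j * prefProb α i j := by
      rw [Finset.mul_sum]
      refine Finset.sum_le_sum fun j _ => ?_
      rw [mul_comm]
      exact mul_le_mul_of_nonneg_left (hpref i j) (hAnn i j)
    have h3 := (abs_le.1 ((hgood.row i).trans hrow)).1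
    have h4 : 3 / 4 * d ≤ ∑ j, A i j := le_trans (by nlinarith) (hdeg i).1
    rw [h1]
    nlinarith
  have hadj : ∃ a b, g.Adj a b := by
    by_contra! h
    have h1 := hD (Classical.arbitrary _)
    have h2 : ∑ j, A (Classical.arbitrary _) j * P (Classical.arbitrary _) j = 0 :=
      Finset.sum_eq_zero fun j _ => by simp [A, edgeWeight_edges, h]
    rw [h2] at h1
    linarith
  set B := 2 * τ * (11 * √(d * L / k)) with hB
  set e := 2 * τ * (11 * √(L / k)) with he
  obtain ⟨hker, x, hx, hfx, hxle⟩ := exists_balanced_perturbation (A := A) (P := P) (ρ := ρ)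
    (d := d) (lam := lam) (B := B) (e := e) (p := p) (κ := lam / 8)
    (edgeWeight_comm _) (edgeWeight_zero_or_one _) (edgeWeight_self _)
    (empProb_nonneg z) (empProb_le_one hk z) (fun i j hij => empProb_add hk z hij)
    (by
      intro i
      have h1 : flow A P ρ i = 2 * τ * ∑ b, A i b * relScore α i b * noise α z i b := by
        rw [flow_apply, Finset.mul_sum]
        refine Finset.sum_congr rfl fun b _ => ?_
        by_cases hib : i = b
        · subst hib; simp [A, edgeWeight_self]
        · rw [empProb_mul_canonicalScore_sub hα hk z hib, relScore, show ‖canonicalScore α‖ = τ from rfl]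
          field_simp
      rw [h1, abs_mul, abs_of_pos (by positivity : 0 < 2 * τ), hB]
      gcongr
      exact hgood.weightedRow i)
    (by
      intro i j hij
      rw [empProb_mul_canonicalScore_sub hα hk z hij, abs_mul, mul_comm, he]
      have h1 := canonicalScore_pos hα i
      have h2 := canonicalScore_pos hα j
      rw [abs_of_pos (by linarith)]
      gcongr
      · linarith [canonicalScore_le_norm α i, canonicalScore_le_norm α j]
      · exact hgood.entry i j)
    (by
      rw [he, hB, mul_div_assoc, Real.sqrt_mul hd0.le]
      exact le_of_eq (by ring))
    hD
    (by
      intro x hx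
      refine (sum_edgeWeight_quadratic_le hp hal hgood.discrepancy hdeg2 (by linarith) K hx).trans ?_
      have h0 : 0 ≤ ∑ i, x i ^ 2 := Finset.sum_nonneg fun i _ => sq_nonneg _
      refine mul_le_mul_of_nonneg_right ?_ h0
      have := mul_le_mul_of_nonneg_right hK hd0.le
      unfold discrepancyBound
      rw [← hddef]
      linarith)
    hdeg2
    hgood.leaveOneOut
    hp (by simp [hddef, mul_comm]) hlam0 rfl (by linarith) (by nlinarith)
  have hsumρ : ∑ i, ρ i = 1 := sum_canonicalScore hα hn
  have hsum : ∑ i, (ρ + x) i = 1 := by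
    simp only [Pi.add_apply, Finset.sum_add_distrib, hx.1, hsumρ, add_zero]
  have hst : IsStationaryDistribution (markovMatrix g P) (ρ + x) :=
    (isStationaryDistribution_iff hadj P _).2
      ⟨⟨nonneg_of_unique_balanced (edgeWeight_comm _) hAnn (empProb_nonneg z) hker hsum hfx, hsum⟩,
        hfx⟩
  have huniq : ∀ y, IsStationaryDistribution (markovMatrix g P) y → y = ρ + x := by
    intro y hy
    obtain ⟨⟨-, hy1⟩, hy2⟩ := (isStationaryDistribution_iff hadj P _).1 hy
    refine sub_eq_zero.1 (hker _ ⟨?_, by simp⟩ (by rw [map_sub, hy2, hfx, sub_zero]))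
    simp only [Pi.sub_apply, Finset.sum_sub_distrib, hy1, hsum, sub_self]
  refine ⟨⟨ρ + x, hst, huniq⟩, fun y hy => ?_⟩
  rw [huniq y hy, add_sub_cancel_left, div_le_iff₀ hτ]
  refine hxle.trans (le_of_eq ?_)
  have h1 : √(d * L / k) = d * √(L / (d * k)) := by
    have : d * L / k = d ^ 2 * (L / (d * k)) := by field_simp
    rw [this, Real.sqrt_mul (by positivity), Real.sqrt_sq hd0.le]
  rw [hB, h1]
  field_simp
  ring

end Estimate

/-! ### Probability of the good event -/

section Probability

lemma IsComparisonModel.indepFun_edges {n k : ℕ} {Ω : Type*} [MeasurableSpace Ω]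
    {μ : Measure Ω} {G : Ω → SimpleGraph (Fin n)} {Z : Pair n → Fin k → Ω → Bool}
    {p : unitInterval} {α : Fin n → ℝ} (h : IsComparisonModel p α μ G Z) :
    IndepFun (fun ω => edges (G ω)) (fun ω (x : Pair n × Fin k) => Z x.1 x.2 ω) μ :=
  h.graph_outcome_indep.comp (measurable_pi_lambda _ measurable_edges) measurable_id

variable {n k : ℕ} {Ω : Type*} [MeasurableSpace Ω] {μ : Measure Ω} [IsProbabilityMeasure μ]
  {G : Ω → SimpleGraph (Fin n)} {Z : Pair n → Fin k → Ω → Bool} {p : unitInterval}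
  {α : Fin n → ℝ}

lemma IsComparisonModel.isBernoulliEdges (h : IsComparisonModel p α μ G Z) :
    IsBernoulliEdges (p : ℝ) (fun ω => edges (G ω)) μ := by
  obtain ⟨hG, hGlaw⟩ := h.graph_law
  obtain ⟨hind, hprob⟩ := iIndepFun_edges_binomialRandom (n := n) p
  refine ⟨?_, fun e => (measurable_edges e).comp_aemeasurable hG, fun e => ?_⟩
  · rw [← hGlaw] at hind
    exact (iIndepFun_map_iff hG measurable_edges).1 hind
  · rw [← hprob e]
    exact h.graph_law.measureReal_eq (measurableSet_setOfPred.2 (measurable_edges e))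

lemma one_sub_le_measureReal {Ω : Type*} [MeasurableSpace Ω] {μ : Measure Ω}
    [IsProbabilityMeasure μ] {s t : Set Ω} (h : ∀ ω, ω ∉ t → ω ∈ s) :
    1 - μ.real t ≤ μ.real s := by
  have hcover : Set.univ ⊆ s ∪ t := fun ω _ => (em (ω ∈ t)).elim Or.inr fun ht => Or.inl (h ω ht)
  have hle := (measureReal_mono hcover (measure_ne_top μ _)).trans (measureReal_union_le _ _)
  rw [probReal_univ] at hle
  linarith

lemma exp_neg_le_one_div_pow (hn : 1 ≤ n) {y : ℝ} (hy : 7 * Real.log n ≤ y) :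
    Real.exp (-y) ≤ 1 / (n : ℝ) ^ 7 := by
  have hn' : (0 : ℝ) < n := by exact_mod_cast hn
  have h7 : Real.exp (7 * Real.log n) = (n : ℝ) ^ 7 := by
    rw [show (7 : ℝ) * Real.log n = ((7 : ℕ) : ℝ) * Real.log n by norm_num, Real.exp_nat_mul,
      Real.exp_log hn']
  rw [← h7, one_div, ← Real.exp_neg]
  exact Real.exp_le_exp.2 (by linarith)

lemma measureReal_exists_le {ι : Type*} [Fintype ι] {s : ι → Set Ω} {q : ℝ}
    (h : ∀ i, μ.real (s i) ≤ q) : μ.real {ω | ∃ i, ω ∈ s i} ≤ Fintype.card ι * q := by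
  have hs : {ω | ∃ i, ω ∈ s i} ⊆ ⋃ i ∈ (Finset.univ : Finset ι), s i := by
    rintro ω ⟨i, hi⟩
    exact Set.mem_biUnion (Finset.mem_coe.2 (Finset.mem_univ i)) hi
  refine (measureReal_mono hs (measure_ne_top μ _)).trans
    ((measureReal_biUnion_finset_le _ _).trans ((Finset.sum_le_sum fun i _ => h i).trans ?_))
  simp

/-- Freeze the graph. The degree bound is part of the event, so that graphs violating it contribute
nothing and for the others it bounds the variance. -/
lemma measureReal_adjacent_noise_le (hα : ∀ i, 0 < α i) (hk : 1 ≤ k)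
    (h : IsComparisonModel p α μ G Z) {d L : ℝ} (hL : 0 < L) (hLd : 4 * L ≤ d) (l : Fin n)
    {u : Fin n → ℝ} (hu : ∀ b, |u b| ≤ 1) :
    μ.real {ω | ∑ b, edgeWeight (edges (G ω)) l b ≤ 2 * d ∧ 11 * √(d * L / k) <
      |∑ b, edgeWeight (edges (G ω)) l b * u b * noise α (fun e m => Z e m ω) l b|} ≤
      2 * Real.exp (-(7 * L)) := by
  refine measureReal_le_of_indepFun
    (X := fun ω (x : Pair n × Fin k) => Z x.1 x.2 ω) (Y := fun ω => edges (G ω))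
    (B := fun z s => ∑ b, edgeWeight s l b ≤ 2 * d ∧ 11 * √(d * L / k) <
      |∑ b, edgeWeight s l b * u b * noise α (fun e m => z (e, m)) l b|)
    (measurable_pi_lambda _ fun x : Pair n × Fin k => h.outcome_measurable x.1 x.2).aemeasurable
    (aemeasurable_pi_lambda _ h.isBernoulliEdges.aemeasurable) h.indepFun_edges.symm
    fun s => ?_
  by_cases hs : ∑ b, edgeWeight s l b ≤ 2 * d
  swap
  · simp [hs]; positivity
  have h01 := edgeWeight_zero_or_one s l
  have hw : ∀ b, |edgeWeight s l b * u b| ≤ 1 := fun b => by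
    rcases h01 b with h0 | h0 <;> simp [h0, hu b]
  have hsq : ∑ b, (edgeWeight s l b * u b) ^ 2 ≤ 2 * d := by
    refine le_trans (Finset.sum_le_sum fun b _ => ?_) hs
    rcases h01 b with h0 | h0
    · simp [h0]
    · simpa [h0] using (sq_le_one_iff_abs_le_one (u b)).2 (hu b)
  refine (measureReal_mono ?_ (measure_ne_top μ _)).trans
    (measureReal_noise_row_ge_le hα hk h.outcome_measurable h.outcome_law h.outcome_indep hw hL
      hLd hsq l)
  intro ω hω
  exact hω.2.le

/-- A union bound: 18 = 8 + 5 · 2, from the discrepancy event and five families of at most n² events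
of probability 2n⁻⁷. For the leave-one-out family the outcomes are frozen first, then the edges away
from l. -/
theorem measureReal_not_isGood_le (hα : ∀ i, 0 < α i) (hn : 2 ≤ n) (hk : 1 ≤ k)
    (h : IsComparisonModel p α μ G Z) {al ka : ℝ} (hal : 0 < al) (hal4 : al ≤ 4) (hka : 0 < ka)
    (hka1 : ka ≤ 1) (hd : 4 * Real.log n ≤ n * (p : ℝ))
    (hdal : 7 * Real.log n ≤ 3 * al ^ 2 / 32 * (n * (p : ℝ)))
    (hdka : 7 * Real.log n ≤ ka ^ 2 / 8 * (n * (p : ℝ))) :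
    μ.real {ω | ¬ IsGood α (p : ℝ) al ka (edges (G ω)) fun e m => Z e m ω} ≤
      18 / (n : ℝ) ^ 5 := by
  have hn1 : 1 ≤ n := by omega
  have hn' : (2 : ℝ) ≤ n := by exact_mod_cast hn
  have hL : 0 < Real.log n := Real.log_pos (by linarith)
  have hp : 0 ≤ (p : ℝ) := p.2.1
  have hE := h.isBernoulliEdges
  set L := Real.log n with hLdef
  set d : ℝ := n * (p : ℝ) with hddef
  set q : ℝ := 1 / (n : ℝ) ^ 7 with hq
  have h7 : 2 * Real.exp (-(7 * L)) ≤ 2 * q := by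
    gcongr; exact exp_neg_le_one_div_pow hn1 le_rfl
  have hka7 : 2 * Real.exp (-(ka ^ 2 / 8 * d)) ≤ 2 * q := by
    gcongr; exact exp_neg_le_one_div_pow hn1 hdka
  let A : Ω → Fin n → Fin n → ℝ := fun ω => edgeWeight (edges (G ω))
  let z : Ω → Pair n → Fin k → Bool := fun ω e m => Z e m ω
  let V : Ω → Fin n → Fin n → ℝ := fun ω l =>
    leaveOneOut (isolate (A ω) l) (empProb (z ω)) (canonicalScore α) l
  let B₁ : Set Ω := {ω | ∃ S T : Finset (Fin n), al * d * (S.card + T.card) <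
      |∑ a ∈ S, ∑ b ∈ T, edgeDeviation p (edges (G ω)) a b|}
  let B₂ : Fin n → Set Ω := fun l => {ω | ka * d < |∑ b, edgeDeviation p (edges (G ω)) l b|}
  let B₃ : Fin n → Set Ω := fun l => {ω | ka * d * ‖V ω l‖ <
    |∑ b, edgeDeviation p (edges (G ω)) l b * (empProb (z ω) b l * V ω l b)|}
  let B₄ : Fin n → Set Ω := fun l => {ω | ∑ b, A ω l b ≤ 2 * d ∧ 11 * √(d * L / k) <
    |∑ b, A ω l b * 1 * noise α (z ω) l b|}
  let B₅ : Fin n → Set Ω := fun l => {ω | ∑ b, A ω l b ≤ 2 * d ∧ 11 * √(d * L / k) <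
    |∑ b, A ω l b * relScore α l b * noise α (z ω) l b|}
  let B₆ : Fin n × Fin n → Set Ω := fun x => {ω | 11 * √(L / k) ≤ |noise α (z ω) x.1 x.2|}
  have h1 : μ.real B₁ ≤ 8 / (n : ℝ) ^ 6 :=
    measureReal_exists_discrepancy_le hE hp hal hal4 hn (exp_neg_le_one_div_pow hn1 hdal)
  have h2 : ∀ l, μ.real (B₂ l) ≤ 2 * q := fun l => by
    refine le_trans (le_of_eq ?_) ((measureReal_row_le hE hp hka (by linarith) l
      (c := fun _ => 1) (v := fun _ => 1) (by simp)).trans hka7)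
    have : Nonempty (Fin n) := ⟨l⟩
    simp [B₂, hddef]
  have h3 : ∀ l, μ.real (B₃ l) ≤ 2 * q := fun l => by
    refine le_trans ?_ hka7
    exact measureReal_le_of_indepFun
      (X := fun ω => edges (G ω)) (Y := fun ω (x : Pair n × Fin k) => Z x.1 x.2 ω)
      (B := fun s y => ka * d * ‖leaveOneOut (isolate (edgeWeight s) l)
          (empProb fun e m => y (e, m)) (canonicalScore α) l‖ <
        |∑ b, edgeDeviation p s l b * (empProb (fun e m => y (e, m)) b l *
          leaveOneOut (isolate (edgeWeight s) l)
            (empProb fun e m => y (e, m)) (canonicalScore α) l b)|)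
      (aemeasurable_pi_lambda _ hE.aemeasurable)
      (measurable_pi_lambda _ fun x : Pair n × Fin k => h.outcome_measurable x.1 x.2).aemeasurable
      h.indepFun_edges fun y => measureReal_leaveOneOut_row_le hE hp hka (by linarith) l
        (c := fun b => empProb (fun e m => y (e, m)) b l) (fun b => by
          rw [abs_of_nonneg (empProb_nonneg _ _ _)]; exact empProb_le_one hk _ _ _)
        (fun A' => leaveOneOut A' (empProb fun e m => y (e, m)) (canonicalScore α) l)
  have h4 : ∀ l, μ.real (B₄ l) ≤ 2 * q := fun l =>
    (measureReal_adjacent_noise_le hα hk h hL hd l (u := fun _ => 1) (by simp)).trans h7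
  have h5 : ∀ l, μ.real (B₅ l) ≤ 2 * q := fun l =>
    (measureReal_adjacent_noise_le hα hk h hL hd l (abs_relScore_le_one hα l)).trans h7
  have h6 : ∀ x, μ.real (B₆ x) ≤ 2 * q := fun x =>
    (measureReal_noise_entry_ge_le hα hk h.outcome_measurable h.outcome_law h.outcome_indep hL
      x.1 x.2).trans h7
  have hsub : {ω | ¬ IsGood α (p : ℝ) al ka (edges (G ω)) fun e m => Z e m ω} ⊆
      B₁ ∪ ({ω | ∃ l, ω ∈ B₂ l} ∪ ({ω | ∃ l, ω ∈ B₃ l} ∪ ({ω | ∃ l, ω ∈ B₄ l} ∪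
        ({ω | ∃ l, ω ∈ B₅ l} ∪ {ω | ∃ x, ω ∈ B₆ x})))) := by
    intro ω hω
    by_contra hc
    simp only [Set.mem_union, not_or, Set.mem_ofPred_eq, not_exists, B₁, B₂, B₃, B₄, B₅, B₆,
      not_lt, not_le, not_and, Prod.forall] at hc
    obtain ⟨c1, c2, c3, c4, c5, c6⟩ := hc
    refine hω ⟨c1, c2, c3, fun l => ?_, fun l => ?_, fun a b => (c6 a b).le⟩
    all_goals
      have hdeg : ∑ b, A ω l b ≤ 2 * d :=
        (degree_bounds hp (c2 l)).2.trans (by rw [← hddef]; nlinarith)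
    · simpa [A] using c4 l hdeg
    · exact c5 l hdeg
  have hu := fun s t : Set Ω => measureReal_union_le (μ := μ) s t
  have hn2 := measureReal_exists_le h2
  have hn3 := measureReal_exists_le h3
  have hn4 := measureReal_exists_le h4
  have hn5 := measureReal_exists_le h5
  have hn6 := measureReal_exists_le h6
  simp only [Fintype.card_prod, Fintype.card_fin] at hn2 hn3 hn4 hn5 hn6
  have e1 : 8 / (n : ℝ) ^ 6 ≤ 8 / (n : ℝ) ^ 5 := by
    gcongr <;> linarith
  have e2 : n * (2 * q) ≤ 2 / (n : ℝ) ^ 5 := by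
    have : n * (2 * q) = 2 / (n : ℝ) ^ 6 := by rw [hq]; field_simp
    rw [this]
    gcongr <;> linarith
  have e3 : ((n * n : ℕ) : ℝ) * (2 * q) = 2 / (n : ℝ) ^ 5 := by
    rw [hq]; push_cast; field_simp
  have e4 : 18 / (n : ℝ) ^ 5 = 9 * (2 / (n : ℝ) ^ 5) := by ring
  have e5 : 8 / (n : ℝ) ^ 5 = 4 * (2 / (n : ℝ) ^ 5) := by ring
  refine (measureReal_mono hsub (measure_ne_top μ _)).trans ?_
  refine (hu _ _).trans ?_
  refine (add_le_add_right (hu _ _) _).trans ?_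
  refine (add_le_add_right (add_le_add_right (hu _ _) _) _).trans ?_
  refine (add_le_add_right (add_le_add_right (add_le_add_right (hu _ _) _) _) _).trans ?_
  refine (add_le_add_right (add_le_add_right (add_le_add_right (add_le_add_right (hu _ _) _) _)
    _) _).trans ?_
  linarith

end Probability

end SpectralRanking
end

/-! ### Choice of constants -/

theorem corollary3p2 (h : ℝ) :
    ∃ c₀ c₁ M : ℝ, 1 < c₀ ∧ 0 < c₁ ∧ 0 < M ∧
      ∀ (n k : ℕ) (p : unitInterval) (α : Fin n → ℝ), 1 ≤ n → 1 ≤ k →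
        (∀ i, 0 < α i) → (∀ i j, α i / α j ≤ h) →
        c₀ * Real.log n ≤ n * (p : ℝ) →
        ∀ {Ω : Type*} [MeasurableSpace Ω] (μ : Measure Ω) [IsProbabilityMeasure μ]
          (G : Ω → SimpleGraph (Fin n)) (Z : SpectralRanking.Pair n → Fin k → Ω → Bool),
          SpectralRanking.IsComparisonModel p α μ G Z →
          1 - M / (n : ℝ) ^ 5 ≤
            μ.real {ω |
              (∃! ρ, SpectralRanking.IsStationaryDistribution
                (SpectralRanking.markovMatrix (G ω)
                  (SpectralRanking.empProb fun e m => Z e m ω)) ρ) ∧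
              ∀ ρ, SpectralRanking.IsStationaryDistribution
                (SpectralRanking.markovMatrix (G ω)
                  (SpectralRanking.empProb fun e m => Z e m ω)) ρ →
                ‖ρ - SpectralRanking.canonicalScore α‖ / ‖SpectralRanking.canonicalScore α‖ ≤
                  c₁ * Real.sqrt (Real.log n / (n * (p : ℝ) * k))} := by
  -- The given h is any real number; the maximum makes the ratio bound positive.
  set H := max h 1 with hH
  have hH1 : 1 ≤ H := le_max_right _ _
  obtain ⟨lam, hlam⟩ : ∃ lam : ℝ, lam = 1 / (4 * (1 + H)) := ⟨_, rfl⟩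
  have hlam0 : 0 < lam := by rw [hlam]; positivity
  have hlam1 : lam ≤ 1 := by
    rw [hlam, div_le_one (by positivity)]; linarith
  -- K makes the distant-digit part 24 · 2^(−K) at most λ; then al makes the near-digit part equal
  -- to λ, for a total of at most 2λ.
  obtain ⟨K, hK⟩ := exists_pow_lt_of_lt_one (by positivity : 0 < lam / 24)
    (by norm_num : (1 / 2 : ℝ) < 1)
  obtain ⟨al, hal⟩ : ∃ al : ℝ, al = lam / (8 * ((K + 1) * 2 ^ K)) := ⟨_, rfl⟩
  have hal0 : 0 < al := by rw [hal]; positivity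
  have halK : al * (8 * ((K + 1) * 2 ^ K)) = lam := by rw [hal]; field_simp
  have hal4 : al ≤ 4 := by
    have h1 : (1 : ℝ) ≤ (K + 1) * 2 ^ K := by
      have : (1 : ℝ) ≤ 2 ^ K := one_le_pow₀ (by norm_num)
      have : (0 : ℝ) ≤ K := Nat.cast_nonneg K
      nlinarith
    nlinarith
  -- The summands of c₀ serve the noise, the discrepancy (75 · 3/32 ≥ 7) and the leave-one-out rows
  -- (4000/512 ≥ 7). The last one also covers 484/λ² and, as log n ≥ 1/2, 128/λ².
  refine ⟨4 + 75 / al ^ 2 + 4000 / lam ^ 2, 44 * ((3 + 2 / lam) / lam), 18, ?_, by positivity,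
    by norm_num, ?_⟩
  · have : 0 < 75 / al ^ 2 := by positivity
    have : 0 < 4000 / lam ^ 2 := by positivity
    linarith
  intro n k p α hn hk hα hratio hnp Ω _ μ _ G Z hmodel
  rcases hn.eq_or_lt with rfl | hn2
  -- For n = 1 the claimed lower bound is 1 − 18 < 0.
  · refine le_trans ?_ measureReal_nonneg
    norm_num
  have hn' : (2 : ℝ) ≤ n := by exact_mod_cast hn2
  have hL : 1 / 2 ≤ Real.log n := by
    have := Real.log_le_log (by norm_num) hn'
    linarith [Real.log_two_gt_d9]
  have h1 : 0 ≤ 75 / al ^ 2 * Real.log n := by positivity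
  have h2 : 0 ≤ 4000 / lam ^ 2 * Real.log n := by positivity
  have hd4 : 4 * Real.log n ≤ n * (p : ℝ) := by linarith
  have hdal : 7 * Real.log n ≤ 3 * al ^ 2 / 32 * (n * (p : ℝ)) := by
    have : 75 / al ^ 2 * Real.log n ≤ n * (p : ℝ) := by linarith
    have := mul_le_mul_of_nonneg_left this (by positivity : 0 ≤ 3 * al ^ 2 / 32)
    have e : 3 * al ^ 2 / 32 * (75 / al ^ 2 * Real.log n) = 225 / 32 * Real.log n := by
      field_simp; ring
    linarith
  have hdlam : 4000 / lam ^ 2 * Real.log n ≤ n * (p : ℝ) := by linarith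
  have hdka : 7 * Real.log n ≤ (lam / 8) ^ 2 / 8 * (n * (p : ℝ)) := by
    have := mul_le_mul_of_nonneg_left hdlam (by positivity : 0 ≤ (lam / 8) ^ 2 / 8)
    have e : (lam / 8) ^ 2 / 8 * (4000 / lam ^ 2 * Real.log n) = 4000 / 512 * Real.log n := by
      field_simp; ring
    linarith
  have hbad := SpectralRanking.measureReal_not_isGood_le hα hn2 hk hmodel hal0 hal4
    (by positivity : 0 < lam / 8) (by linarith) hd4 hdal hdka
  have hinv : 0 < 1 / lam ^ 2 := by positivity
  have e1 : ∀ c : ℝ, c / lam ^ 2 = c * (1 / lam ^ 2) := fun c => by ring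
  rw [e1] at hdlam
  refine (sub_le_sub_left hbad 1).trans (SpectralRanking.one_sub_le_measureReal fun ω hω => ?_)
  exact SpectralRanking.stationary_of_isGood (K := K) hα (by linarith)
    (fun i j => (hratio i j).trans (le_max_left _ _)) hn hk p.2.1 p.2.2 hlam hal0.le
    (by nlinarith) (by rw [e1]; nlinarith) (by rw [e1]; nlinarith) (not_not.1 hω)
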